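/- **Setting.** Let $m\ge 2$ agents be the vertices of a connected undirected graph $\mathcal G$, and let $W\in\mathbb R^{m\times m}$ be symmetric positive semidefinite with $W_{ij}=0$ whenever $i\ne j$ are not adjacent and $\ker W=\operatorname{span}\{\mathbf 1\}$. Let $B\in\mathbb R^{p\times d}$ with $\ker B\ne\{0\}$, and let $f_1,\dots,f_m:\mathbb R^d\to\mathbb R$ be differentiable, $\mu$-strongly convex ($\mu>0$) and $L$-smooth, i.e. $f_i(x)+\langle\nabla f_i(x),y-x\rangle+\frac{\mu}{2}\|y-x\|^2\le f_i(y)\le f_i(x)+\langle\nabla f_i(x),y-x\rangle+\frac{L}{2}\|y-x\|^2$. Consider $$\min F(\mathbf x)=\sum_{i=1}^m f_i(x_i)\quad\text{s.t. } \mathbf W\mathbf x=0,\ \mathbf B\mathbf x=0,\qquad \mathbf W=W\otimes I,\ \mathbf B=I\otimes B .$$ Let $E\in\mathbb R^{d\times d_t}$ have columns that form an orthonormal basis of $\ker B$, and put $h_i(t)=f_i(Et)$, $H(\mathbf t)=\sum_i h_i(t_i)$, $H^*(\mathbf z)=\sup_{\mathbf t}\{\langle \mathbf z,\mathbf t\rangle-H(\mathbf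 t)\}$. For positive semidefinite $M\neq0$ let $\chi(M)=\lambda_{\max}(M)/\lambda_{\min}^+(M)$, where $\lambda^+_{\min}$ is the least nonzero eigenvalue. For a polynomial $P$ and $M=P(W)$, the dual objective is $\Psi_M(\mathbf z)=H^*((M\otimes I)\mathbf z)$. The *locally dual method* with $P$, constants $\mu_t,L_t$ and starting point $\mathbf z^0$ performs $N$ steps of the fast gradient method on $\Psi_M$: $\mathbf z^{-1}=\mathbf z^0$, $\mathbf q=\mathbf z^k+\beta(\mathbf z^k-\mathbf z^{k-1})$, $\mathbf z^{k+1}=\mathbf q-\eta\nabla\Psi_M(\mathbf q)$, with $\eta=\mu_t/\lambda_{\max}(M)^2$, $\beta=\frac{s-1}{s+1}$, $s=\sqrt{L_t/\mu_t}\,\chi(M)$, and returns $\mathbf x^N=(I\otimes E)\nabla H^*((M\otimes I)\mathbf z^N)$. One evaluation of $\nabla h_i^*$ at every node counts as one dual-oracle call, and one exchange of vectors between neighbours (one multiplication by $\mathbf W$) as one communication; $P(W)$ is applied by Horner's scheme. The *plain* method has $P(x)=x$. The *Chebyshev accelerated* method has $P(x)=P_K(x)=1-T_K(\theta(x))/T_K(\theta(0))$,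 where $T_K$ is the Chebyshev polynomial, $K=\lceil\sqrt{2\chi(W)}\,\rceil$, and $\theta$ is the affine map with $\theta(\lambda_{\min}^+(W)/2)=1$, $\theta(\lambda_{\max}(W))=-1$. For $\gamma>0$ let $\mathbf A\mathbf x=(\mathbf B\mathbf x,\gamma\mathbf W\mathbf x)$. Call $\mathbf x$ *$\varepsilon$-accurate* if $F(\mathbf x)-F(\mathbf y)\le\varepsilon$ for every feasible $\mathbf y$ and $\|\mathbf A\mathbf x\|\le\varepsilon$. **Claim.** There is a universal constant $C>0$ such that in every such setting the following hold. 1. $d_t=d-\operatorname{rank}B$. The largest $\mu_t$ for which all $h_i$ are $\mu_t$-strongly convex and the least $L_t$ for which all $h_i$ are $L_t$-smooth exist, and $\mu_t\ge\mu$, $L_t\le L$. 2. $\sup_{\mathbf B\mathbf x=0}\{\langle\mathbf v,\mathbf x\rangle-F(\mathbf x)\}=H^*((I\otimes E^\top)\mathbf v)$ for all $\mathbf v\in\mathbb R^{md}$, and $\nabla H^*(\mathbf z)$ is the unique maximizer of $\langle\mathbf z,\mathbf t\rangle-H(\mathbf t)$. For $M=W$ and for $M=P_K(W)$, $\Psi_M$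 has a minimizer, and the minimum of the constrained problem is attained and equals $-\min\Psi_M$. For every polynomial $P$, multiplication by $P(W)\otimes I$ takes $\deg P$ communications, and the gradient that the method computes (by two such multiplications and one dual-oracle call) is $\nabla\Psi_{P(W)}$. 3. $\deg P_K\le C\sqrt{\chi(W)}$, $P_K(W)$ is positive semidefinite with the same kernel as $W$, and $\chi(P_K(W))\le C$. 4. Let $\mu_t>0$ and $L_t$ be any constants such that all $h_i$ are $\mu_t$-strongly convex and $L_t$-smooth (in particular the best ones). Then $H^*$ is $\frac1{\mu_t}$-smooth and $\frac1{L_t}$-strongly convex. 5. Let $\mu_t,L_t$ be as in 4, and let $\gamma>0$ and $0<\varepsilon\le1$. Let $\mathbf z^*$ be a minimizer of $\Psi_W$ with $\|\mathbf z^*\|\le R$ and $\|\mathbf z^0-\mathbf z^*\|\le R$. Then there is $N$ such that the plain method returns an $\varepsilon$-accurate point after any number $N'\ge N$ of steps, and its $N$ steps, including the computation of $\mathbf x^N$, use at most $$C\sqrt{\tfrac{L_t}{\mu_t}}\;\chi(W)\,\log\frac{2+\Theta}{\varepsilon},\qquad \Theta=\sqrt{\tfrac{L_t}{\mu_t}}\,\chi(W)\,\frac{\lambda_{\max}(W)^2}{\mu_t}\,R(R+\gamma),$$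 dual-oracle calls, and at most that many communications. That is $O\big(\sqrt{L_t/\mu_t}\,\chi(W)\log\frac1\varepsilon\big)$, up to the logarithmic dependence on the problem parameters. 6. Let $\mu_t,L_t,\gamma,\varepsilon$ be as in 5, and let $\mathbf z^*$ be a minimizer of $\Psi_{P_K(W)}$ with $\|\mathbf z^*\|\le R$ and $\|\mathbf z^0-\mathbf z^*\|\le R$. Then there is $N$ such that the Chebyshev accelerated method returns an $\varepsilon$-accurate point after any number $N'\ge N$ of steps, and its $N$ steps, including the computation of $\mathbf x^N$, use a number $\bar N$ of dual-oracle calls and a number of communications with $$\bar N\le C\sqrt{\tfrac{L_t}{\mu_t}}\,\log\frac{2+\Theta'}{\varepsilon},\quad \Theta'=\sqrt{\tfrac{L_t}{\mu_t}}\,\frac{1}{\mu_t}\,R\big(R+\gamma\lambda_{\max}(W)\big),\qquad \#\text{communications}\le C\,\bar N\sqrt{\chi(W)} .$$ That is, $\bar N=O\big(\sqrt{L_t/\mu_t}\log\frac1\varepsilon\big)$ oracle calls, up to the logarithmic dependence on the problem parameters, and $O(\bar N\sqrt{\chi(W)})$ communications. -/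

import Mathlib

open scoped RealInnerProductSpace

namespace LocallyDual

noncomputable section

/-- `ℝⁿ` with the Euclidean norm. -/
abbrev Vec (n : ℕ) : Type := EuclideanSpace ℝ (Fin n)

/-- Stacked vectors `col(x₁, …, x_m)` with blocks in `ℝⁿ`, with the Euclidean norm of `ℝ^{mn}`. -/
abbrev Stack (m n : ℕ) : Type := PiLp 2 (fun _ : Fin m => Vec n)

section Functions

variable {X : Type} [NormedAddCommGroup X] [InnerProductSpace ℝ X] [CompleteSpace X]

/-- A differentiable `c`-strongly convex function. -/
def StronglyConvexWith (c : ℝ) (g : X → ℝ) : Prop :=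
  Differentiable ℝ g ∧
    ∀ x y, g x + ⟪gradient g x, y - x⟫ + c / 2 * ‖y - x‖ ^ 2 ≤ g y

/-- A differentiable `c`-smooth function. -/
def SmoothWith (c : ℝ) (g : X → ℝ) : Prop :=
  Differentiable ℝ g ∧
    ∀ x y, g y ≤ g x + ⟪gradient g x, y - x⟫ + c / 2 * ‖y - x‖ ^ 2

/-- The convex conjugate `g*(z) = sup_t {⟨z, t⟩ - g t}`. -/
def conjugate (g : X → ℝ) (z : X) : ℝ := ⨆ t, (⟪z, t⟫ - g t)

end Functions

section Matrices

variable {m n k : ℕ}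

/-- Maximal eigenvalue of a symmetric positive semidefinite matrix. -/
def lamMax (M : Matrix (Fin m) (Fin m) ℝ) : ℝ := sSup (spectrum ℝ M)

/-- Minimal nonzero eigenvalue of a symmetric positive semidefinite matrix. -/
def lamMinPos (M : Matrix (Fin m) (Fin m) ℝ) : ℝ := sInf (spectrum ℝ M \ {0})

/-- The condition number `χ(M) = λ_max(M) / λ_min⁺(M)`. -/
def chi (M : Matrix (Fin m) (Fin m) ℝ) : ℝ := lamMax M / lamMinPos M

/-- The action of `M ⊗ I` on stacked vectors. -/
def kronAct (M : Matrix (Fin m) (Fin m) ℝ) (z : Stack m n) : Stack m n :=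
  WithLp.toLp 2 fun i => ∑ j, M i j • z j

/-- The action of `I ⊗ D` on stacked vectors: every block is multiplied by `D`. -/
def blockAct (D : Matrix (Fin k) (Fin n) ℝ) (z : Stack m n) : Stack m k :=
  WithLp.toLp 2 fun i => Matrix.toEuclideanLin D (z i)

/-- The stacked constraint operator `A x = (B x, γ W x)`, with `B`, `W` acting as `I ⊗ B`,
`W ⊗ I`. -/
def constraintMap (B : Matrix (Fin k) (Fin n) ℝ) (W : Matrix (Fin m) (Fin m) ℝ) (γ : ℝ)
    (x : Stack m n) : WithLp 2 (Stack m k × Stack m n) :=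
  WithLp.toLp 2 (blockAct B x, γ • kronAct W x)

/-- `W` is a mixing matrix of the graph `G`. -/
structure IsMixing (G : SimpleGraph (Fin m)) (W : Matrix (Fin m) (Fin m) ℝ) : Prop where
  posSemidef : W.PosSemidef
  compatible : ∀ i j, i ≠ j → ¬ G.Adj i j → W i j = 0
  kernel : ∀ v : Fin m → ℝ, W.mulVec v = 0 ↔ ∀ i j, v i = v j

/-- The columns of `E` form an orthonormal basis of `ker B`. -/
structure IsKernelBasis (B : Matrix (Fin k) (Fin n) ℝ) {r : ℕ}
    (E : Matrix (Fin n) (Fin r) ℝ) : Prop where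
  orthonormal : E.transpose * E = 1
  range_eq : ∀ x : Fin n → ℝ, B.mulVec x = 0 ↔ ∃ t, E.mulVec t = x

/-- The Chebyshev polynomial `P_K(x) = 1 - T_K(θ(x)) / T_K(θ(0))` with `K = ⌈√(2χ(W))⌉`, where `θ`
is the affine map that sends `b` to `-1` and `a` to `1`, for `a = λ_min⁺(W) / 2` and
`b = λ_max(W)`. Halving the lower end of the spectral interval keeps `a < b` when `χ(W) = 1`. -/
def chebPoly (W : Matrix (Fin m) (Fin m) ℝ) : Polynomial ℝ :=
  let a := lamMinPos W / 2
  let b := lamMax W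
  let K : ℕ := ⌈√(2 * chi W)⌉₊
  let T := Polynomial.Chebyshev.T ℝ (K : ℤ)
  1 - Polynomial.C (T.eval ((b + a) / (b - a)))⁻¹ *
    T.comp (Polynomial.C ((b + a) / (b - a)) - Polynomial.C (2 / (b - a)) * Polynomial.X)

end Matrices

section Problem

variable {m d p r : ℕ}

/-- The separable sum `(x₁, …, x_m) ↦ ∑ᵢ gᵢ(xᵢ)`. -/
def sepSum (g : Fin m → Vec d → ℝ) (x : Stack m d) : ℝ := ∑ i, g i (x i)

/-- The reparametrized local objectives `hᵢ(t) = fᵢ(E t)`. -/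
def reparam (f : Fin m → Vec d → ℝ) (E : Matrix (Fin d) (Fin r) ℝ) (i : Fin m) (t : Vec r) : ℝ :=
  f i (Matrix.toEuclideanLin E t)

/-- The dual objective `z ↦ H*(M z)`, where `H(t) = ∑ᵢ hᵢ(tᵢ)` and the consensus constraint is
written as `(M ⊗ I) t = 0`. -/
def dualObj (h : Fin m → Vec r → ℝ) (M : Matrix (Fin m) (Fin m) ℝ) (z : Stack m r) : ℝ :=
  conjugate (sepSum h) (kronAct M z)

/-- Feasible points of `min F(x)` subject to `W x = 0`, `B x = 0`. -/
def feasible (B : Matrix (Fin p) (Fin d) ℝ) (W : Matrix (Fin m) (Fin m) ℝ) : Set (Stack m d) :=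
  {x | kronAct W x = 0 ∧ blockAct B x = 0}

/-- `x` satisfies `F(x) - F(y) ≤ ε` for every feasible `y`, and `‖A x‖ ≤ ε`. -/
def IsAccurate (f : Fin m → Vec d → ℝ) (B : Matrix (Fin p) (Fin d) ℝ)
    (W : Matrix (Fin m) (Fin m) ℝ) (γ ε : ℝ) (x : Stack m d) : Prop :=
  (∀ y ∈ feasible B W, sepSum f x - sepSum f y ≤ ε) ∧ ‖constraintMap B W γ x‖ ≤ ε

end Problem

/-! Decentralized computations with a count of oracle calls (per node) and of communication
rounds. Costs arise only in `dualOracle` and `gossip`; everything else is local arithmetic. -/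

/-- A result together with the number of oracle calls made at each node and the number of
communication rounds that were used to compute it. -/
structure Counted (α : Type) where
  val : α
  oracleCalls : ℕ
  communications : ℕ

instance : Monad Counted where
  pure a := ⟨a, 0, 0⟩
  bind c k := ⟨(k c.val).val, c.oracleCalls + (k c.val).oracleCalls,
    c.communications + (k c.val).communications⟩

section Algorithm

variable {m d r : ℕ}

/-- Every node `i` calls its dual oracle `∇hᵢ*` once, at its own block. -/
def dualOracle (h : Fin m → Vec r → ℝ) (z : Stack m r) : Counted (Stack m r) :=
  ⟨WithLp.toLp 2 fun i => gradient (conjugate (h i)) (z i), 1, 0⟩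

open Classical in
/-- One communication round: every node receives the blocks of its neighbours in `G` and combines
them with its own block, with the weights in its row of `W`. -/
def gossip (G : SimpleGraph (Fin m)) (W : Matrix (Fin m) (Fin m) ℝ) (z : Stack m r) :
    Counted (Stack m r) :=
  ⟨WithLp.toLp 2 fun i => W i i • z i + ∑ j, if G.Adj i j then W i j • z j else 0, 0, 1⟩

/-- Horner's scheme, one communication round per step. -/
def hornerLoop (G : SimpleGraph (Fin m)) (W : Matrix (Fin m) (Fin m) ℝ) (P : Polynomial ℝ)
    (v : Stack m r) : ℕ → Stack m r → Counted (Stack m r)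
  | 0, y => pure y
  | k + 1, y => do
    let u ← gossip G W y
    hornerLoop G W P v k (u + P.coeff k • v)

/-- Decentralized multiplication by `P(W) ⊗ I`. -/
def polyGossip (G : SimpleGraph (Fin m)) (W : Matrix (Fin m) (Fin m) ℝ) (P : Polynomial ℝ)
    (v : Stack m r) : Counted (Stack m r) :=
  hornerLoop G W P v P.natDegree (P.leadingCoeff • v)

/-- Decentralized evaluation of the gradient of the dual objective `z ↦ H*(P(W) z)`. -/
def dualGrad (G : SimpleGraph (Fin m)) (W : Matrix (Fin m) (Fin m) ℝ) (P : Polynomial ℝ)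
    (h : Fin m → Vec r → ℝ) (z : Stack m r) : Counted (Stack m r) := do
  let q ← polyGossip G W P z
  let t ← dualOracle h q
  polyGossip G W P t

/-- The fast gradient method with step size `η` and momentum `β`, from the last two iterates. -/
def fastGradientLoop (grad : Stack m r → Counted (Stack m r)) (η β : ℝ) :
    ℕ → Stack m r → Stack m r → Counted (Stack m r)
  | 0, _, z => pure z
  | k + 1, zPrev, z => do
    let q := z + β • (z - zPrev)
    let g ← grad q
    fastGradientLoop grad η β k z (q - η • g)

/-- The locally dual method: `N` steps of the fast gradient method for the dual objective
`z ↦ H*(M z)`, `M = P(W)`, started at `z⁰`, and then the primal point `E t` with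
`t = ∇H*(M z^N)`. The dual objective is `λ_max(M)²/μ_t`-smooth and has condition number
`(L_t/μ_t) χ(M)²` on the orthogonal complement of the kernel of `M`. Taking `P(x) = x` gives the
plain method, and `P = chebPoly W` the Chebyshev accelerated one. -/
def locallyDual (G : SimpleGraph (Fin m)) (W : Matrix (Fin m) (Fin m) ℝ) (P : Polynomial ℝ)
    (f : Fin m → Vec d → ℝ) (E : Matrix (Fin d) (Fin r) ℝ) (μt Lt : ℝ) (z₀ : Stack m r) (N : ℕ) :
    Counted (Stack m d) := do
  let M := Polynomial.aeval W P
  let s := √(Lt / μt) * chi M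
  let z ← fastGradientLoop (dualGrad G W P (reparam f E))
    (μt / lamMax M ^ 2) ((s - 1) / (s + 1)) N z₀ z₀
  let q ← polyGossip G W P z
  let t ← dualOracle (reparam f E) q
  pure (blockAct E t)

end Algorithm

end

end LocallyDual

open LocallyDual

/-!
The conjugate of a `μ`-strongly convex, `L`-smooth function `H` is `1/μ`-smooth and
`1/L`-strongly convex, so `Ψ = H* ∘ M` is `λ_max(M)²/μ`-smooth, and strongly convex with constant
`λ_min⁺(M)²/L` along `(ker M)ᗮ`. Gradients of `Ψ` lie in that subspace, so the iterates of the fast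
gradient method differ from `z⁰` only by its elements, and the usual Lyapunov function contracts
by the factor `1 - 1/s` in every step, where `s = √(L/μ) χ(M)`.

The gap `Ψ(z) - min Ψ` controls the primal point `t = ∇H*(M z)`: its residual `M t` is `∇Ψ(z)`, and
the Fenchel equality gives `H(t) - min H ≤ H(t) + Ψ(z) = ⟪z, ∇Ψ(z)⟫`, where the minimum is over
`M t = 0`. Replacing `W` by `P_K(W)` moves the nonzero eigenvalues into `[2/3, 4/3]`, since
`T_K(θ(0)) ≥ 1 + K² (θ(0) - 1) ≥ 3`, and costs `deg P_K = O(√χ(W))` communications.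
-/

namespace LocallyDual

open Filter

noncomputable section

section ConvexAnalysis

variable {X : Type} [NormedAddCommGroup X] [InnerProductSpace ℝ X] [CompleteSpace X]
  {g : X → ℝ} {c L : ℝ}

theorem gradient_eq_zero_of_isLocalMin {x : X} (h : IsLocalMin g x) : gradient g x = 0 := by
  rw [gradient, h.fderiv_eq_zero, map_zero]

theorem hasGradientAt_sub_inner {x : X} (hg : DifferentiableAt ℝ g x) (z : X) :
    HasGradientAt (fun t => g t - ⟪z, t⟫) (gradient g x - z) x := by
  rw [hasGradientAt_iff_hasFDerivAt, map_sub]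
  exact hg.hasGradientAt.hasFDerivAt.sub (InnerProductSpace.toDual ℝ X z).hasFDerivAt

theorem hasGradientAt_of_abs_sub_le {x v : X} {K : ℝ}
    (h : ∀ y, |g y - g x - ⟪v, y - x⟫| ≤ K * ‖y - x‖ ^ 2) : HasGradientAt g v x := by
  rw [hasGradientAt_iff_isLittleO]
  have hO : (fun y => g y - g x - ⟪v, y - x⟫) =O[nhds x] fun y => ‖y - x‖ ^ 2 :=
    Asymptotics.IsBigO.of_bound K <| .of_forall fun y => by
      rw [Real.norm_eq_abs, Real.norm_of_nonneg (by positivity)]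
      exact h y
  exact hO.trans_isLittleO <| (Asymptotics.isLittleO_norm_pow_id one_lt_two).comp_tendsto
    (k := fun y => y - x) (by simpa using (continuous_sub_right x).tendsto x)

theorem StronglyConvexWith.sub_inner (hg : StronglyConvexWith c g) (z : X) :
    StronglyConvexWith c fun t => g t - ⟪z, t⟫ := by
  refine ⟨fun t => (hasGradientAt_sub_inner (hg.1 t) z).differentiableAt, fun x y => ?_⟩
  rw [(hasGradientAt_sub_inner (hg.1 x) z).gradient, inner_sub_left]
  linarith [hg.2 x y, inner_sub_right (𝕜 := ℝ) z y x]

theorem StronglyConvexWith.apply_add_inner_le (hg : StronglyConvexWith c g) (hc : 0 ≤ c) (x y : X) :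
    g x + ⟪gradient g x, y - x⟫ ≤ g y := by
  have : 0 ≤ c / 2 * ‖y - x‖ ^ 2 := by positivity
  linarith [hg.2 x y]

theorem StronglyConvexWith.isMaxOn_iff_gradient_eq (hg : StronglyConvexWith c g) (hc : 0 ≤ c)
    {z t : X} :
    IsMaxOn (fun t' => ⟪z, t'⟫ - g t') Set.univ t ↔ gradient g t = z := by
  constructor
  · intro hmax
    have hmin : IsLocalMin (fun t' => g t' - ⟪z, t'⟫) t :=
      .of_forall fun y => by linarith [isMaxOn_iff.1 hmax y (Set.mem_univ y)]
    have h0 := gradient_eq_zero_of_isLocalMin hmin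
    rwa [(hasGradientAt_sub_inner (hg.1 t) z).gradient, sub_eq_zero] at h0
  · rintro rfl
    refine isMaxOn_iff.2 fun y _ => ?_
    linarith [hg.apply_add_inner_le hc t y, inner_sub_right (𝕜 := ℝ) (gradient g t) y t]

theorem SmoothWith.apply_sub_le (hg : SmoothWith L g) (hL : L ≠ 0) (x u : X) :
    g (x - L⁻¹ • u) ≤ g x - ⟪gradient g x, u⟫ / L + ‖u‖ ^ 2 / (2 * L) := by
  have h := hg.2 x (x - L⁻¹ • u)
  rw [sub_sub_cancel_left, inner_neg_right, inner_smul_right, norm_neg, norm_smul, mul_pow,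
    Real.norm_eq_abs, sq_abs] at h
  refine h.trans (le_of_eq ?_)
  field_simp
  ring

theorem SmoothWith.apply_gradient_step_le (hg : SmoothWith L g) (hL : L ≠ 0) (x : X) :
    g (x - L⁻¹ • gradient g x) ≤ g x - ‖gradient g x‖ ^ 2 / (2 * L) := by
  refine (hg.apply_sub_le hL x (gradient g x)).trans (le_of_eq ?_)
  rw [real_inner_self_eq_norm_sq]
  field_simp
  ring

theorem SmoothWith.norm_sub_gradient_sq_le (hs : SmoothWith L g) (hL : L ≠ 0)
    (hg : StronglyConvexWith c g) (hc : 0 ≤ c) (x y : X) :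
    g x + ⟪gradient g x, y - x⟫ + ‖gradient g y - gradient g x‖ ^ 2 / (2 * L) ≤ g y := by
  set u := gradient g y - gradient g x with hu
  have hstep := hs.apply_sub_le hL y u
  have hconv := hg.apply_add_inner_le hc x (y - L⁻¹ • u)
  rw [sub_right_comm, inner_sub_right, inner_smul_right] at hconv
  have hy : ⟪gradient g y, u⟫ = ⟪gradient g x, u⟫ + ‖u‖ ^ 2 := by
    rw [← real_inner_self_eq_norm_sq, ← inner_add_left, hu, add_sub_cancel]
  have hdiv : ⟪gradient g y, u⟫ / L = L⁻¹ * ⟪gradient g x, u⟫ + 2 * (‖u‖ ^ 2 / (2 * L)) := by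
    rw [hy]
    field_simp
  linarith

theorem StronglyConvexWith.le_of_smoothWith [Nontrivial X] (hg : StronglyConvexWith c g)
    (hs : SmoothWith L g) : c ≤ L := by
  obtain ⟨y, hy⟩ := exists_ne (0 : X)
  have hpos : 0 < ‖y - 0‖ ^ 2 := by
    rw [sub_zero]
    exact pow_pos (norm_pos_iff.2 hy) 2
  nlinarith [hg.2 0 y, hs.2 0 y]

section BestConstants

variable {ι : Type*} [Nonempty ι] [Nontrivial X] {f : ι → X → ℝ}

theorem exists_isGreatest_stronglyConvexWith (hf : ∀ i, StronglyConvexWith c (f i))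
    (hs : ∀ i, SmoothWith L (f i)) :
    ∃ b, IsGreatest {b | ∀ i, StronglyConvexWith b (f i)} b := by
  have hbdd : BddAbove {b | ∀ i, StronglyConvexWith b (f i)} :=
    ⟨L, fun b hb => (hb (Classical.arbitrary ι)).le_of_smoothWith (hs _)⟩
  have hclosed : IsClosed {b | ∀ i, StronglyConvexWith b (f i)} := by
    have hset : {b | ∀ i, StronglyConvexWith b (f i)} = ⋂ i, ⋂ x, ⋂ y,
        {b | f i x + ⟪gradient (f i) x, y - x⟫ + b / 2 * ‖y - x‖ ^ 2 ≤ f i y} := by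
      ext b
      simp only [Set.mem_iInter, Set.mem_ofPred_eq]
      exact ⟨fun h i => (h i).2, fun h i => ⟨(hf i).1, h i⟩⟩
    rw [hset]
    exact isClosed_iInter fun i => isClosed_iInter fun x => isClosed_iInter fun y =>
      isClosed_le (by fun_prop) continuous_const
  exact ⟨_, hclosed.isGreatest_csSup ⟨c, hf⟩ hbdd⟩

theorem exists_isLeast_smoothWith (hf : ∀ i, StronglyConvexWith c (f i))
    (hs : ∀ i, SmoothWith L (f i)) :
    ∃ b, IsLeast {b | ∀ i, SmoothWith b (f i)} b := by
  have hbdd : BddBelow {b | ∀ i, SmoothWith b (f i)} :=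
    ⟨c, fun b hb => (hf _).le_of_smoothWith (hb (Classical.arbitrary ι))⟩
  have hclosed : IsClosed {b | ∀ i, SmoothWith b (f i)} := by
    have hset : {b | ∀ i, SmoothWith b (f i)} = ⋂ i, ⋂ x, ⋂ y,
        {b | f i y ≤ f i x + ⟪gradient (f i) x, y - x⟫ + b / 2 * ‖y - x‖ ^ 2} := by
      ext b
      simp only [Set.mem_iInter, Set.mem_ofPred_eq]
      exact ⟨fun h i => (h i).2, fun h i => ⟨(hs i).1, h i⟩⟩
    rw [hset]
    exact isClosed_iInter fun i => isClosed_iInter fun x => isClosed_iInter fun y =>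
      isClosed_le continuous_const (by fun_prop)
  exact ⟨_, hclosed.isLeast_csInf ⟨L, hs⟩ hbdd⟩

end BestConstants

end ConvexAnalysis

section Conjugate

variable {X : Type} [NormedAddCommGroup X] [InnerProductSpace ℝ X] [CompleteSpace X]
  [FiniteDimensional ℝ X] {g : X → ℝ} {c L : ℝ}

theorem StronglyConvexWith.tendsto_cocompact (hg : StronglyConvexWith c g) (hc : 0 < c) :
    Tendsto g (cocompact X) atTop := by
  have hnorm := tendsto_norm_cocompact_atTop (E := X)
  have hquad : Tendsto (fun x : X => ‖x‖ * (c / 2 * ‖x‖ + -‖gradient g 0‖) + g 0)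
      (cocompact X) atTop :=
    tendsto_atTop_add_const_right _ _ <| hnorm.atTop_mul_atTop₀ <|
      tendsto_atTop_add_const_right _ _ (hnorm.const_mul_atTop (by positivity))
  refine tendsto_atTop_mono (fun x => ?_) hquad
  have hx := hg.2 0 x
  rw [sub_zero] at hx
  linarith [neg_le_of_abs_le (abs_real_inner_le_norm (gradient g 0) x)]

theorem StronglyConvexWith.gradient_surjective (hg : StronglyConvexWith c g) (hc : 0 < c) :
    Function.Surjective (gradient g) := by
  intro z
  obtain ⟨t, ht⟩ := (hg.sub_inner z).1.continuous.exists_forall_le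
    ((hg.sub_inner z).tendsto_cocompact hc)
  exact ⟨t, (hg.isMaxOn_iff_gradient_eq hc.le).1 <| isMaxOn_iff.2 fun y _ => by linarith [ht y]⟩

theorem StronglyConvexWith.isLUB_conjugate (hg : StronglyConvexWith c g) (hc : 0 < c) (z : X) :
    IsLUB (Set.range fun t => ⟪z, t⟫ - g t) (conjugate g z) := by
  obtain ⟨t, rfl⟩ := hg.gradient_surjective hc z
  have hmax := isMaxOn_iff.1 ((hg.isMaxOn_iff_gradient_eq hc.le).2 (rfl : gradient g t = _))
  exact isLUB_ciSup ⟨_, Set.forall_mem_range.2 fun y => hmax y (Set.mem_univ y)⟩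

theorem StronglyConvexWith.inner_sub_le_conjugate (hg : StronglyConvexWith c g) (hc : 0 < c)
    (z t : X) : ⟪z, t⟫ - g t ≤ conjugate g z :=
  (hg.isLUB_conjugate hc z).1 ⟨t, rfl⟩

theorem StronglyConvexWith.conjugate_gradient (hg : StronglyConvexWith c g) (hc : 0 < c) (t : X) :
    conjugate g (gradient g t) = ⟪gradient g t, t⟫ - g t := by
  have hmax := isMaxOn_iff.1 ((hg.isMaxOn_iff_gradient_eq hc.le).2 (rfl : gradient g t = _))
  exact (hg.isLUB_conjugate hc _).unique <| IsGreatest.isLUB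
    ⟨⟨t, rfl⟩, Set.forall_mem_range.2 fun y => hmax y (Set.mem_univ y)⟩

theorem StronglyConvexWith.conjugate_bregman (hg : StronglyConvexWith c g) (hc : 0 < c) (t u : X) :
    conjugate g (gradient g u) - conjugate g (gradient g t) -
      ⟪t, gradient g u - gradient g t⟫ = g t - g u - ⟪gradient g u, t - u⟫ := by
  rw [hg.conjugate_gradient hc, hg.conjugate_gradient hc, inner_sub_right, inner_sub_right,
    real_inner_comm t (gradient g u), real_inner_comm t (gradient g t)]
  ring

theorem StronglyConvexWith.conjugate_bregman_le (hg : StronglyConvexWith c g) (hc : 0 < c)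
    (t u : X) : conjugate g (gradient g u) - conjugate g (gradient g t) -
      ⟪t, gradient g u - gradient g t⟫ ≤ 1 / c / 2 * ‖gradient g u - gradient g t‖ ^ 2 := by
  rw [hg.conjugate_bregman hc]
  set w := gradient g u - gradient g t with hw
  have hinner : ⟪gradient g u, t - u⟫ = ⟪w, t - u⟫ - ⟪gradient g t, u - t⟫ := by
    rw [hw, inner_sub_left, ← neg_sub t u, inner_neg_right]
    ring
  have hcs := neg_le_of_abs_le (abs_real_inner_le_norm w (t - u))
  rw [norm_sub_rev t u] at hcs
  have hsq : 1 / c / 2 * ‖w‖ ^ 2 + c / 2 * ‖u - t‖ ^ 2 - ‖w‖ * ‖u - t‖ =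
      (‖w‖ - c * ‖u - t‖) ^ 2 / (2 * c) := by
    field_simp
    ring
  have : 0 ≤ (‖w‖ - c * ‖u - t‖) ^ 2 / (2 * c) := by positivity
  linarith [hg.2 t u]

theorem StronglyConvexWith.hasGradientAt_conjugate (hg : StronglyConvexWith c g) (hc : 0 < c)
    (t : X) : HasGradientAt (conjugate g) t (gradient g t) := by
  refine hasGradientAt_of_abs_sub_le (K := 1 / c / 2) fun w => ?_
  obtain ⟨u, rfl⟩ := hg.gradient_surjective hc w
  rw [abs_of_nonneg]
  · exact hg.conjugate_bregman_le hc t u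
  · rw [hg.conjugate_bregman hc]
    linarith [hg.apply_add_inner_le hc.le u t]

theorem StronglyConvexWith.gradient_conjugate (hg : StronglyConvexWith c g) (hc : 0 < c) (t : X) :
    gradient (conjugate g) (gradient g t) = t :=
  (hg.hasGradientAt_conjugate hc t).gradient

theorem StronglyConvexWith.gradient_gradient_conjugate (hg : StronglyConvexWith c g) (hc : 0 < c)
    (z : X) : gradient g (gradient (conjugate g) z) = z :=
  Function.LeftInverse.rightInverse_of_surjective (hg.gradient_conjugate hc)
    (hg.gradient_surjective hc) z

theorem StronglyConvexWith.isMaxOn_iff_eq_gradient_conjugate (hg : StronglyConvexWith c g)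
    (hc : 0 < c) {z t : X} :
    IsMaxOn (fun t' => ⟪z, t'⟫ - g t') Set.univ t ↔ t = gradient (conjugate g) z := by
  rw [hg.isMaxOn_iff_gradient_eq hc.le]
  constructor
  · rintro rfl
    exact (hg.gradient_conjugate hc t).symm
  · rintro rfl
    exact hg.gradient_gradient_conjugate hc z

theorem StronglyConvexWith.differentiable_conjugate (hg : StronglyConvexWith c g) (hc : 0 < c) :
    Differentiable ℝ (conjugate g) := by
  intro z
  obtain ⟨t, rfl⟩ := hg.gradient_surjective hc z
  exact (hg.hasGradientAt_conjugate hc t).differentiableAt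

theorem StronglyConvexWith.smoothWith_conjugate (hg : StronglyConvexWith c g) (hc : 0 < c) :
    SmoothWith (1 / c) (conjugate g) := by
  refine ⟨hg.differentiable_conjugate hc, fun z w => ?_⟩
  obtain ⟨t, rfl⟩ := hg.gradient_surjective hc z
  obtain ⟨u, rfl⟩ := hg.gradient_surjective hc w
  rw [hg.gradient_conjugate hc]
  linarith [hg.conjugate_bregman_le hc t u]

theorem SmoothWith.stronglyConvexWith_conjugate (hs : SmoothWith L g) (hL : L ≠ 0)
    (hg : StronglyConvexWith c g) (hc : 0 < c) : StronglyConvexWith (1 / L) (conjugate g) := by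
  refine ⟨hg.differentiable_conjugate hc, fun z w => ?_⟩
  obtain ⟨t, rfl⟩ := hg.gradient_surjective hc z
  obtain ⟨u, rfl⟩ := hg.gradient_surjective hc w
  have hco := hs.norm_sub_gradient_sq_le hL hg hc.le u t
  have hdiv : 1 / L / 2 * ‖gradient g t - gradient g u‖ ^ 2 =
      ‖gradient g t - gradient g u‖ ^ 2 / (2 * L) := by
    field_simp
  rw [hg.gradient_conjugate hc, norm_sub_rev, hdiv]
  linarith [hg.conjugate_bregman hc t u]

end Conjugate

section Composition

variable {X Y : Type} [NormedAddCommGroup X] [InnerProductSpace ℝ X]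
  [NormedAddCommGroup Y] [InnerProductSpace ℝ Y] [CompleteSpace Y]
  {g : X → ℝ} {T : Y →L[ℝ] X} {c l Λ : ℝ}

theorem apply_starProjection_orthogonal_ker (T : Y →L[ℝ] X) (y : Y) :
    T (T.kerᗮ.starProjection y) = T y := by
  have hker : y - T.kerᗮ.starProjection y ∈ T.ker := by
    have hmem := Submodule.sub_starProjection_mem_orthogonal (K := T.kerᗮ) y
    rwa [T.ker.orthogonal_orthogonal] at hmem
  have hzero : T (y - T.kerᗮ.starProjection y) = 0 := hker
  rw [map_sub, sub_eq_zero] at hzero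
  exact hzero.symm

variable [CompleteSpace X]

/-- Strong convexity of a differentiable function in the directions of a closed subspace `K`, for a
function that does not vary in the directions orthogonal to `K`. -/
structure StronglyConvexAlong (K : Submodule ℝ X) [K.HasOrthogonalProjection] (c : ℝ)
    (g : X → ℝ) : Prop where
  differentiable : Differentiable ℝ g
  gradient_mem : ∀ x, gradient g x ∈ K
  lower_bound : ∀ x y,
    g x + ⟪gradient g x, y - x⟫ + c / 2 * ‖K.starProjection (y - x)‖ ^ 2 ≤ g y

open ContinuousLinearMap in
theorem hasGradientAt_comp (hg : Differentiable ℝ g) (T : Y →L[ℝ] X) (y : Y) :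
    HasGradientAt (g ∘ T) (adjoint T (gradient g (T y))) y := by
  rw [hasGradientAt_iff_hasFDerivAt]
  refine ((hg (T y)).hasGradientAt.hasFDerivAt.comp y T.hasFDerivAt).congr_fderiv ?_
  ext v
  simp [adjoint_inner_left]

theorem gradient_comp (hg : Differentiable ℝ g) (T : Y →L[ℝ] X) (y : Y) :
    gradient (g ∘ T) y = T.adjoint (gradient g (T y)) :=
  (hasGradientAt_comp hg T y).gradient

theorem inner_gradient_comp (hg : Differentiable ℝ g) (T : Y →L[ℝ] X) (x y : Y) :
    ⟪gradient (g ∘ T) x, y - x⟫ = ⟪gradient g (T x), T y - T x⟫ := by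
  rw [gradient_comp hg, ContinuousLinearMap.adjoint_inner_left, map_sub]

theorem StronglyConvexWith.comp_isometry (hg : StronglyConvexWith c g)
    (hT : ∀ y, ‖T y‖ = ‖y‖) : StronglyConvexWith c (g ∘ T) := by
  refine ⟨hg.1.comp T.differentiable, fun x y => ?_⟩
  rw [inner_gradient_comp hg.1, ← hT, map_sub]
  exact hg.2 (T x) (T y)

theorem SmoothWith.comp_isometry (hg : SmoothWith c g) (hT : ∀ y, ‖T y‖ = ‖y‖) :
    SmoothWith c (g ∘ T) := by
  refine ⟨hg.1.comp T.differentiable, fun x y => ?_⟩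
  rw [inner_gradient_comp hg.1, ← hT, map_sub]
  exact hg.2 (T x) (T y)

theorem SmoothWith.comp (hg : SmoothWith c g) (hc : 0 ≤ c) (hT : ∀ y, ‖T y‖ ≤ Λ * ‖y‖) :
    SmoothWith (c * Λ ^ 2) (g ∘ T) := by
  refine ⟨hg.1.comp T.differentiable, fun x y => ?_⟩
  have hsq : c / 2 * ‖T y - T x‖ ^ 2 ≤ c * Λ ^ 2 / 2 * ‖y - x‖ ^ 2 := by
    calc c / 2 * ‖T y - T x‖ ^ 2 ≤ c / 2 * (Λ * ‖y - x‖) ^ 2 := by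
          rw [← map_sub]
          gcongr
          exact hT _
      _ = c * Λ ^ 2 / 2 * ‖y - x‖ ^ 2 := by ring
  rw [inner_gradient_comp hg.1]
  exact (hg.2 (T x) (T y)).trans (by simpa only [Function.comp_apply] using by linarith)

theorem gradient_comp_mem (hg : Differentiable ℝ g) (T : Y →L[ℝ] X) (y : Y) :
    gradient (g ∘ T) y ∈ T.kerᗮ := by
  intro v hv
  rw [gradient_comp hg, ContinuousLinearMap.adjoint_inner_right]
  exact (congrArg (inner ℝ · _) (LinearMap.mem_ker.1 hv)).trans (inner_zero_left _)

theorem StronglyConvexWith.comp (hg : StronglyConvexWith c g) (hc : 0 ≤ c) (hl : 0 ≤ l)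
    (hT : ∀ y ∈ T.kerᗮ, l * ‖y‖ ≤ ‖T y‖) :
    StronglyConvexAlong T.kerᗮ (c * l ^ 2) (g ∘ T) := by
  refine ⟨hg.1.comp T.differentiable, gradient_comp_mem hg.1 T, fun x y => ?_⟩
  have hsq : c * l ^ 2 / 2 * ‖T.kerᗮ.starProjection (y - x)‖ ^ 2 ≤
      c / 2 * ‖T y - T x‖ ^ 2 := by
    calc _ = c / 2 * (l * ‖T.kerᗮ.starProjection (y - x)‖) ^ 2 := by ring
      _ ≤ c / 2 * ‖T y - T x‖ ^ 2 := by
          rw [← map_sub, ← apply_starProjection_orthogonal_ker T (y - x)]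
          gcongr
          exact hT _ (Submodule.starProjection_apply_mem _ _)
  rw [inner_gradient_comp hg.1]
  exact le_trans (by simpa only [Function.comp_apply] using by linarith) (hg.2 (T x) (T y))

end Composition

section FastGradient

variable {X : Type} [NormedAddCommGroup X]

/-- The iterates of the fast gradient method with step size `η` and momentum `β`, from the last two
of them. -/
def fastGradientIter [Module ℝ X] (grad : X → X) (η β : ℝ) : ℕ → X → X → X
  | 0, _, z => z
  | k + 1, w, z => fastGradientIter grad η β k z
      (z + β • (z - w) - η • grad (z + β • (z - w)))

variable [InnerProductSpace ℝ X] {Ψ : X → ℝ} {s M : ℝ} {zs : X}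
  (K : Submodule ℝ X) [K.HasOrthogonalProjection]

/-- The Lyapunov function of the fast gradient method at consecutive iterates `w`, `z`, for an
`M`-smooth function with condition number `s ^ 2` along `K`. -/
def lyapunov (Ψ : X → ℝ) (s M : ℝ) (zs w z : X) : ℝ :=
  Ψ z - Ψ zs + M / s ^ 2 / 2 * ‖K.starProjection (w + s • (z - w) - zs)‖ ^ 2

variable {K}

theorem norm_sq_convexCombination_le {σ : ℝ} (hσ : 0 ≤ σ) (hσ1 : σ ≤ 1) (a b : X) :
    ‖(1 - σ) • a + σ • b‖ ^ 2 ≤ (1 - σ) * ‖a‖ ^ 2 + σ * ‖b‖ ^ 2 :=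
  ((convexOn_univ_norm (E := X)).pow (fun x _ => norm_nonneg x) 2).2 (Set.mem_univ a)
    (Set.mem_univ b) (sub_nonneg.2 hσ1) hσ (by ring)

theorem inner_starProjection_of_mem {g : X} (hg : g ∈ K) (x : X) :
    ⟪g, K.starProjection x⟫ = ⟪g, x⟫ := by
  rw [← K.inner_starProjection_left_eq_right, Submodule.starProjection_eq_self_iff.2 hg]

/-- With `σ = 1 / s`, the auxiliary point `z + s (z⁺ - z)` of the next step is a convex combination
of the current one, `w + s (z - w)`, and the extrapolated point `y`, shifted by `-(s / M) g`. -/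
theorem fastGradient_auxiliary_point (hs : 0 < s) (w z g zs : X) :
    let y := z + ((s - 1) / (s + 1)) • (z - w)
    z + s • (y - M⁻¹ • g - z) - zs =
      (1 - s⁻¹) • (w + s • (z - w) - zs) + s⁻¹ • (y - zs) - (s / M) • g := by
  intro y
  have hcoef : (s - s⁻¹) * ((s - 1) / (s + 1)) = (1 - s⁻¹) * (s - 1) := by
    field_simp
    ring
  simp only [y]
  linear_combination (norm := module) hcoef • (z - w)

theorem fastGradient_sub_extrapolation (hs : 0 < s) (w z : X) :
    let y := z + ((s - 1) / (s + 1)) • (z - w)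
    z - y = s⁻¹ • (y - (w + s • (z - w))) := by
  intro y
  have hcoef : s⁻¹ * ((s - 1) / (s + 1) + 1 - s) = -((s - 1) / (s + 1)) := by
    field_simp
    ring
  simp only [y]
  linear_combination (norm := module) -hcoef • (z - w)

variable [CompleteSpace X]

theorem lyapunov_fastGradient_step_le (hs : 1 ≤ s) (hM : 0 < M) (hsm : SmoothWith M Ψ)
    (hsc : StronglyConvexAlong K (M / s ^ 2) Ψ) (zs w z : X) :
    let y := z + ((s - 1) / (s + 1)) • (z - w)
    lyapunov K Ψ s M zs z (y - M⁻¹ • gradient Ψ y) ≤ (1 - s⁻¹) * lyapunov K Ψ s M zs w z := by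
  intro y
  have hs0 : 0 < s := zero_lt_one.trans_le hs
  set g := gradient Ψ y
  have hg : g ∈ K := hsc.gradient_mem y
  set a := K.starProjection (w + s • (z - w) - zs) with ha
  set b := K.starProjection (y - zs) with hb
  have hdescent : Ψ (y - M⁻¹ • g) ≤ Ψ y - ‖g‖ ^ 2 / (2 * M) :=
    hsm.apply_gradient_step_le hM.ne' y
  have hz : Ψ y + s⁻¹ * (⟪g, b⟫ - ⟪g, a⟫) ≤ Ψ z := by
    have hinner : ⟪g, z - y⟫ = s⁻¹ * (⟪g, b⟫ - ⟪g, a⟫) := by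
      rw [ha, hb, inner_starProjection_of_mem hg, inner_starProjection_of_mem hg, ← inner_sub_right,
        sub_sub_sub_cancel_right, fastGradient_sub_extrapolation hs0, inner_smul_right]
    have : 0 ≤ M / s ^ 2 / 2 * ‖K.starProjection (z - y)‖ ^ 2 := by positivity
    linarith [hsc.lower_bound y z]
  have hzs : Ψ y - ⟪g, b⟫ + M / s ^ 2 / 2 * ‖b‖ ^ 2 ≤ Ψ zs := by
    have hlow := hsc.lower_bound y zs
    rwa [← neg_sub y zs, inner_neg_right, map_neg, norm_neg, ← inner_starProjection_of_mem hg,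
      ← sub_eq_add_neg] at hlow
  set u := (1 - s⁻¹) • a + s⁻¹ • b with hu
  have hnext : K.starProjection (z + s • (y - M⁻¹ • g - z) - zs) = u - (s / M) • g := by
    rw [fastGradient_auxiliary_point hs0, map_sub, map_add, map_smul, map_smul, map_smul,
      Submodule.starProjection_eq_self_iff.2 hg]
  have hsq : M / s ^ 2 / 2 * ‖u - (s / M) • g‖ ^ 2 = M / s ^ 2 / 2 * ‖u‖ ^ 2 -
      s⁻¹ * ((1 - s⁻¹) * ⟪g, a⟫ + s⁻¹ * ⟪g, b⟫) + ‖g‖ ^ 2 / (2 * M) := by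
    rw [norm_sub_sq_real, real_inner_comm, real_inner_smul_left, norm_smul, mul_pow,
      Real.norm_eq_abs, sq_abs, hu, inner_add_right, inner_smul_right, inner_smul_right]
    field_simp
  have hconv := mul_le_mul_of_nonneg_left
    (norm_sq_convexCombination_le (inv_nonneg.2 hs0.le) (inv_le_one_of_one_le₀ hs) a b)
    (show 0 ≤ M / s ^ 2 / 2 by positivity)
  have hσz := mul_le_mul_of_nonneg_left hz (sub_nonneg.2 (inv_le_one_of_one_le₀ hs))
  have hσzs := mul_le_mul_of_nonneg_left hzs (inv_nonneg.2 hs0.le)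
  simp only [lyapunov, hnext, hsq]
  linarith

theorem fastGradientIter_sub_le (hs : 1 ≤ s) (hM : 0 < M) (hsm : SmoothWith M Ψ)
    (hsc : StronglyConvexAlong K (M / s ^ 2) Ψ) (zs : X) (N : ℕ) (w z : X) :
    Ψ (fastGradientIter (gradient Ψ) M⁻¹ ((s - 1) / (s + 1)) N w z) - Ψ zs ≤
      (1 - s⁻¹) ^ N * lyapunov K Ψ s M zs w z := by
  induction N generalizing w z with
  | zero =>
    have : 0 ≤ M / s ^ 2 / 2 * ‖K.starProjection (w + s • (z - w) - zs)‖ ^ 2 := by positivity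
    simp only [fastGradientIter, lyapunov, pow_zero, one_mul]
    linarith
  | succ N ih =>
    have hrate : 0 ≤ (1 - s⁻¹) ^ N := pow_nonneg (sub_nonneg.2 (inv_le_one_of_one_le₀ hs)) N
    rw [pow_succ, mul_assoc]
    exact (ih _ _).trans
      (mul_le_mul_of_nonneg_left (lyapunov_fastGradient_step_le hs hM hsm hsc zs w z) hrate)

theorem SmoothWith.sub_le_of_isMin (hsm : SmoothWith M Ψ) (hzs : ∀ z, Ψ zs ≤ Ψ z) (z : X) :
    Ψ z - Ψ zs ≤ M / 2 * ‖z - zs‖ ^ 2 := by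
  have h := hsm.2 zs z
  rw [gradient_eq_zero_of_isLocalMin (.of_forall hzs), inner_zero_left] at h
  linarith

theorem SmoothWith.norm_gradient_sq_le (hsm : SmoothWith M Ψ) (hM : 0 < M)
    (hzs : ∀ z, Ψ zs ≤ Ψ z) (z : X) : ‖gradient Ψ z‖ ^ 2 ≤ 2 * M * (Ψ z - Ψ zs) := by
  have h := (hzs _).trans (hsm.apply_gradient_step_le hM.ne' z)
  rw [le_sub_comm, div_le_iff₀' (by positivity)] at h
  exact h

theorem StronglyConvexAlong.norm_starProjection_sub_sq_le {c : ℝ}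
    (hsc : StronglyConvexAlong K c Ψ) (hzs : ∀ z, Ψ zs ≤ Ψ z) (z : X) :
    c / 2 * ‖K.starProjection (z - zs)‖ ^ 2 ≤ Ψ z - Ψ zs := by
  have h := hsc.lower_bound zs z
  rw [gradient_eq_zero_of_isLocalMin (.of_forall hzs), inner_zero_left] at h
  linarith

theorem fastGradientIter_gap_le (hs : 1 ≤ s) (hM : 0 < M) (hsm : SmoothWith M Ψ)
    (hsc : StronglyConvexAlong K (M / s ^ 2) Ψ) (hzs : ∀ z, Ψ zs ≤ Ψ z) {z₀ : X} {R : ℝ}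
    (hR : ‖z₀ - zs‖ ≤ R) (N : ℕ) :
    Ψ (fastGradientIter (gradient Ψ) M⁻¹ ((s - 1) / (s + 1)) N z₀ z₀) - Ψ zs ≤
      M * (R * Real.exp (-(N / (2 * s)))) ^ 2 := by
  have : 0 < s := zero_lt_one.trans_le hs
  have hinit : lyapunov K Ψ s M zs z₀ z₀ ≤ M * R ^ 2 := by
    have hbound := mul_le_mul_of_nonneg_left
      (pow_le_pow_left₀ (norm_nonneg _) hR 2) (half_pos hM).le
    have hproj := hsc.norm_starProjection_sub_sq_le hzs z₀
    rw [lyapunov, sub_self, smul_zero, add_zero]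
    linarith [hsm.sub_le_of_isMin hzs z₀]
  have hrate : (1 - s⁻¹) ^ N ≤ Real.exp (-(N / (2 * s))) ^ 2 := by
    calc (1 - s⁻¹) ^ N ≤ Real.exp (-s⁻¹) ^ N :=
          pow_le_pow_left₀ (sub_nonneg.2 (inv_le_one_of_one_le₀ hs)) (Real.one_sub_le_exp_neg _) N
      _ = Real.exp (-(N / (2 * s))) ^ 2 := by
          rw [← Real.exp_nat_mul, ← Real.exp_nat_mul]
          congr 1
          push_cast
          field_simp
  calc _ ≤ (1 - s⁻¹) ^ N * lyapunov K Ψ s M zs z₀ z₀ :=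
        fastGradientIter_sub_le hs hM hsm hsc zs N z₀ z₀
    _ ≤ Real.exp (-(N / (2 * s))) ^ 2 * (M * R ^ 2) :=
        mul_le_mul hrate hinit (by
          rw [lyapunov]
          have := hzs z₀
          have : 0 ≤ Ψ z₀ - Ψ zs := by linarith
          positivity) (by positivity)
    _ = M * (R * Real.exp (-(N / (2 * s)))) ^ 2 := by ring

theorem norm_gradient_le_of_gap_le (hM : 0 < M) (hsm : SmoothWith M Ψ)
    (hzs : ∀ z, Ψ zs ≤ Ψ z) {z : X} {δ : ℝ} (hδ : 0 ≤ δ) (hgap : Ψ z - Ψ zs ≤ M * δ ^ 2) :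
    ‖gradient Ψ z‖ ≤ 3 / 2 * (M * δ) := by
  refine le_of_sq_le_sq ?_ (by positivity)
  nlinarith [hsm.norm_gradient_sq_le hM hzs z, sq_nonneg (M * δ)]

theorem norm_starProjection_sub_le_of_gap_le (hs : 0 < s) (hM : 0 < M)
    (hsc : StronglyConvexAlong K (M / s ^ 2) Ψ) (hzs : ∀ z, Ψ zs ≤ Ψ z) {z : X} {δ : ℝ}
    (hδ : 0 ≤ δ) (hgap : Ψ z - Ψ zs ≤ M * δ ^ 2) :
    ‖K.starProjection (z - zs)‖ ≤ 3 / 2 * (s * δ) := by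
  have h := (hsc.norm_starProjection_sub_sq_le hzs z).trans hgap
  have hsq : ‖K.starProjection (z - zs)‖ ^ 2 ≤ 2 * (s * δ) ^ 2 := by
    have : M / s ^ 2 / 2 * ‖K.starProjection (z - zs)‖ ^ 2 * (2 * s ^ 2 / M) ≤
        M * δ ^ 2 * (2 * s ^ 2 / M) := by gcongr
    field_simp at this
    linarith
  refine le_of_sq_le_sq ?_ (by positivity)
  nlinarith [sq_nonneg (s * δ)]

theorem inner_gradient_le_of_gap_le (hs : 1 ≤ s) (hM : 0 < M) (hsm : SmoothWith M Ψ)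
    (hsc : StronglyConvexAlong K (M / s ^ 2) Ψ) (hzs : ∀ z, Ψ zs ≤ Ψ z) {z : X} {R e : ℝ}
    (hR : ‖zs‖ ≤ R) (he : 0 ≤ e) (he1 : e ≤ 1) (hgap : Ψ z - Ψ zs ≤ M * (R * e) ^ 2) :
    ⟪z, gradient Ψ z⟫ ≤ 4 * (s * M * R ^ 2) * e := by
  have hR0 : 0 ≤ R := (norm_nonneg _).trans hR
  have hgrad := norm_gradient_le_of_gap_le hM hsm hzs (mul_nonneg hR0 he) hgap
  have hdist := norm_starProjection_sub_le_of_gap_le (zero_lt_one.trans_le hs) hM hsc hzs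
    (mul_nonneg hR0 he) hgap
  have hsplit : ⟪z, gradient Ψ z⟫ =
      ⟪zs, gradient Ψ z⟫ + ⟪K.starProjection (z - zs), gradient Ψ z⟫ := by
    rw [real_inner_comm _ (K.starProjection _), inner_starProjection_of_mem (hsc.gradient_mem z),
      real_inner_comm _ z, real_inner_comm _ zs, ← inner_add_right, add_sub_cancel]
  calc ⟪z, gradient Ψ z⟫
      ≤ ‖zs‖ * ‖gradient Ψ z‖ + ‖K.starProjection (z - zs)‖ * ‖gradient Ψ z‖ := by
        rw [hsplit]
        exact add_le_add (real_inner_le_norm _ _) (real_inner_le_norm _ _)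
    _ ≤ R * (3 / 2 * (M * (R * e))) + 3 / 2 * (s * (R * e)) * (3 / 2 * (M * (R * e))) := by
        gcongr
    _ = 3 / 2 * (1 * M * R ^ 2) * e + 9 / 4 * (s * M * R ^ 2) * e * e := by ring
    _ ≤ 3 / 2 * (s * M * R ^ 2) * e + 9 / 4 * (s * M * R ^ 2) * e * 1 := by gcongr
    _ ≤ 4 * (s * M * R ^ 2) * e := by
        have : 0 ≤ s * M * R ^ 2 * e := by positivity
        linarith

end FastGradient

section Duality

variable {X Y : Type} [NormedAddCommGroup X] [InnerProductSpace ℝ X] [FiniteDimensional ℝ X]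
  [CompleteSpace X] [NormedAddCommGroup Y] [InnerProductSpace ℝ Y] [CompleteSpace Y]
  {g : X → ℝ} {c L : ℝ} {T : Y →L[ℝ] X}

theorem StronglyConvexWith.exists_gradient_mem_range (hg : StronglyConvexWith c g) (hc : 0 < c)
    (T : Y →L[ℝ] X) : ∃ z t, T.adjoint t = 0 ∧ gradient g t = T z := by
  let K : Submodule ℝ X := T.adjoint.ker
  obtain ⟨t, ht⟩ := (hg.comp_isometry (T := K.subtypeL) fun _ => rfl).gradient_surjective hc 0
  have hortho : gradient g t ∈ Kᗮ := fun u hu => by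
    have h0 := inner_zero_left (𝕜 := ℝ) (⟨u, hu⟩ : K)
    rw [← ht, gradient_comp hg.1, ContinuousLinearMap.adjoint_inner_left] at h0
    rwa [real_inner_comm]
  have hrange : gradient g t ∈ T.range := by
    rwa [← Submodule.orthogonal_orthogonal T.range, T.orthogonal_range]
  obtain ⟨z, hz⟩ := hrange
  exact ⟨z, t, t.2, hz.symm⟩

theorem StronglyConvexWith.neg_le_conjugate (hg : StronglyConvexWith c g) (hc : 0 < c) (z : Y)
    {t : X} (ht : T.adjoint t = 0) : -g t ≤ conjugate g (T z) := by
  have h := hg.inner_sub_le_conjugate hc (T z) t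
  rwa [← ContinuousLinearMap.adjoint_inner_right, ht, inner_zero_right, zero_sub] at h

theorem StronglyConvexWith.exists_dual_minimizer (hg : StronglyConvexWith c g) (hc : 0 < c)
    (T : Y →L[ℝ] X) : ∃ z t, T.adjoint t = 0 ∧ conjugate g (T z) = -g t ∧
      ∀ z', conjugate g (T z) ≤ conjugate g (T z') := by
  obtain ⟨z, t, ht, hz⟩ := hg.exists_gradient_mem_range hc T
  have hval : conjugate g (T z) = -g t := by
    rw [← hz, hg.conjugate_gradient hc, hz, ← ContinuousLinearMap.adjoint_inner_right, ht,
      inner_zero_right, zero_sub]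
  exact ⟨z, t, ht, hval, fun z' => hval ▸ hg.neg_le_conjugate hc z' ht⟩

theorem StronglyConvexWith.isLeast_neg_dual (hg : StronglyConvexWith c g) (hc : 0 < c) {z : Y}
    (hz : ∀ z', conjugate g (T z) ≤ conjugate g (T z')) :
    IsLeast (g '' {t | T.adjoint t = 0}) (-conjugate g (T z)) := by
  obtain ⟨z', t, ht, hval, hmin⟩ := hg.exists_dual_minimizer hc T
  refine ⟨⟨t, ht, ?_⟩, ?_⟩
  · linarith [hz z', hmin z]
  · rintro _ ⟨u, hu, rfl⟩
    linarith [hg.neg_le_conjugate hc z hu]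

theorem StronglyConvexWith.add_conjugate_eq_inner_gradient (hg : StronglyConvexWith c g)
    (hc : 0 < c) (T : Y →L[ℝ] X) (z : Y) :
    g (gradient (conjugate g) (T z)) + conjugate g (T z) =
      ⟪z, gradient (conjugate g ∘ T) z⟫ := by
  have h := hg.conjugate_gradient hc (gradient (conjugate g) (T z))
  rw [hg.gradient_gradient_conjugate hc] at h
  rw [gradient_comp (hg.differentiable_conjugate hc), ContinuousLinearMap.adjoint_inner_right, h,
    add_sub_cancel]

theorem fastGradientIter_primal_accuracy {l Λ s R : ℝ} (hg : StronglyConvexWith c g) (hc : 0 < c)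
    (hsm : SmoothWith L g) (hL : 0 < L) (hl : 0 < l) (hΛ : 0 < Λ)
    (hTl : ∀ z ∈ T.kerᗮ, l * ‖z‖ ≤ ‖T z‖) (hTΛ : ∀ z, ‖T z‖ ≤ Λ * ‖z‖)
    (hs : s = √(L / c) * (Λ / l)) (hs1 : 1 ≤ s) {z₀ zs : Y}
    (hzs : ∀ z, conjugate g (T zs) ≤ conjugate g (T z)) (hR : ‖zs‖ ≤ R) (hR₀ : ‖z₀ - zs‖ ≤ R)
    (N : ℕ) :
    let z := fastGradientIter (gradient (conjugate g ∘ T)) (c / Λ ^ 2) ((s - 1) / (s + 1)) N z₀ z₀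
    let t := gradient (conjugate g) (T z)
    let δ := Real.exp (-(N / (2 * s)))
    (∀ u, T.adjoint u = 0 → g t - g u ≤ 4 * (s * (Λ ^ 2 / c) * R ^ 2) * δ) ∧
      ‖T.adjoint t‖ ≤ 2 * (Λ ^ 2 / c * R) * δ := by
  intro z t δ
  have hM : 0 < Λ ^ 2 / c := by positivity
  have hR0 : 0 ≤ R := (norm_nonneg _).trans hR
  have hδ : δ ≤ 1 := by
    have : 0 ≤ (N : ℝ) / (2 * s) := by positivity
    exact Real.exp_le_one_iff.2 (neg_nonpos.2 this)
  have hsmooth : SmoothWith (Λ ^ 2 / c) (conjugate g ∘ T) := by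
    have h := (hg.smoothWith_conjugate hc).comp (by positivity) hTΛ
    rwa [one_div_mul_eq_div] at h
  have hconvex : StronglyConvexAlong T.kerᗮ (Λ ^ 2 / c / s ^ 2) (conjugate g ∘ T) := by
    have h := (hsm.stronglyConvexWith_conjugate hL.ne' hg hc).comp (by positivity) hl.le hTl
    have hcond : Λ ^ 2 / c / s ^ 2 = 1 / L * l ^ 2 := by
      rw [hs, mul_pow, Real.sq_sqrt (by positivity)]
      field_simp
    rwa [hcond]
  have hgap : (conjugate g ∘ T) z - (conjugate g ∘ T) zs ≤ Λ ^ 2 / c * (R * δ) ^ 2 := by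
    have h := fastGradientIter_gap_le hs1 hM hsmooth hconvex hzs hR₀ N
    rwa [inv_div] at h
  refine ⟨fun u hu => ?_, ?_⟩
  · calc g t - g u ≤ g t + conjugate g (T z) := by linarith [hg.neg_le_conjugate hc z hu]
      _ = ⟪z, gradient (conjugate g ∘ T) z⟫ := hg.add_conjugate_eq_inner_gradient hc T z
      _ ≤ 4 * (s * (Λ ^ 2 / c) * R ^ 2) * δ :=
        inner_gradient_le_of_gap_le hs1 hM hsmooth hconvex hzs hR (Real.exp_pos _).le hδ hgap
  · have hgrad := norm_gradient_le_of_gap_le hM hsmooth hzs (by positivity) hgap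
    have : 0 ≤ Λ ^ 2 / c * R * δ := by positivity
    rw [← gradient_comp (hg.differentiable_conjugate hc)]
    linarith

end Duality

section SymmetricOperators

variable {Y : Type*} [NormedAddCommGroup Y] [InnerProductSpace ℝ Y] [FiniteDimensional ℝ Y]
  {T : Module.End ℝ Y}

theorem inner_eigenvectorBasis_apply (hT : T.IsSymmetric)
    (i : Fin (Module.finrank ℝ Y)) (y : Y) : ⟪hT.eigenvectorBasis rfl i, T y⟫ =
      hT.eigenvalues rfl i * ⟪hT.eigenvectorBasis rfl i, y⟫ := by
  rw [← hT, hT.apply_eigenvectorBasis, real_inner_smul_left]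
  rfl

theorem norm_apply_le_of_eigenvalues_le (hT : T.IsSymmetric) {Λ : ℝ}
    (hΛ : ∀ x, T.HasEigenvalue x → |x| ≤ Λ) (h0 : 0 ≤ Λ) (y : Y) : ‖T y‖ ≤ Λ * ‖y‖ := by
  rw [← sq_le_sq₀ (norm_nonneg _) (by positivity), mul_pow,
    ← (hT.eigenvectorBasis rfl).sum_sq_inner_right,
    ← (hT.eigenvectorBasis rfl).sum_sq_inner_right y, Finset.mul_sum]
  refine Finset.sum_le_sum fun i _ => ?_
  rw [inner_eigenvectorBasis_apply, mul_pow]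
  exact mul_le_mul_of_nonneg_right
    (sq_le_sq' (abs_le.1 (hΛ _ (hT.hasEigenvalue_eigenvalues rfl i))).1
      (abs_le.1 (hΛ _ (hT.hasEigenvalue_eigenvalues rfl i))).2) (sq_nonneg _)

theorem le_norm_apply_of_le_eigenvalues (hT : T.IsSymmetric) {l : ℝ}
    (hl : ∀ x, T.HasEigenvalue x → x ≠ 0 → l ≤ |x|) (h0 : 0 ≤ l) {y : Y}
    (hy : y ∈ (LinearMap.ker T)ᗮ) : l * ‖y‖ ≤ ‖T y‖ := by
  rw [← sq_le_sq₀ (by positivity) (norm_nonneg _), mul_pow,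
    ← (hT.eigenvectorBasis rfl).sum_sq_inner_right y,
    ← (hT.eigenvectorBasis rfl).sum_sq_inner_right (T y), Finset.mul_sum]
  refine Finset.sum_le_sum fun i _ => ?_
  rw [inner_eigenvectorBasis_apply, mul_pow]
  by_cases hi : hT.eigenvalues rfl i = 0
  · have hker : hT.eigenvectorBasis rfl i ∈ LinearMap.ker T := by
      rw [LinearMap.mem_ker, hT.apply_eigenvectorBasis, hi]
      exact zero_smul ℝ _
    rw [hy _ hker, zero_pow two_ne_zero, mul_zero, mul_zero]
  · have h := hl _ (hT.hasEigenvalue_eigenvalues rfl i) hi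
    rw [← sq_abs (hT.eigenvalues rfl i)]
    exact mul_le_mul_of_nonneg_right (pow_le_pow_left₀ h0 h 2) (sq_nonneg _)

end SymmetricOperators

section Spectrum

variable {m : ℕ} {M : Matrix (Fin m) (Fin m) ℝ}

theorem le_lamMax {x : ℝ} (hx : x ∈ spectrum ℝ M) : x ≤ lamMax M :=
  le_csSup Matrix.finite_real_spectrum.bddAbove hx

theorem lamMinPos_le {x : ℝ} (hx : x ∈ spectrum ℝ M) (h0 : x ≠ 0) : lamMinPos M ≤ x :=
  csInf_le (Matrix.finite_real_spectrum.subset Set.sdiff_subset).bddBelow ⟨hx, h0⟩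

theorem spectrum_nonneg_of_posSemidef (hM : M.PosSemidef) {x : ℝ} (hx : x ∈ spectrum ℝ M) :
    0 ≤ x :=
  (Matrix.posSemidef_iff_isHermitian_and_spectrum_nonneg.1 hM).2 hx

theorem spectrum_diff_zero_nonempty (hM : M.IsHermitian) (h0 : M ≠ 0) :
    (spectrum ℝ M \ {0}).Nonempty := by
  by_contra hne
  rw [Set.not_nonempty_iff_eq_empty, Set.sdiff_eq_empty] at hne
  exact h0 (hM.eigenvalues_eq_zero_iff.1
    (funext fun i => hne (hM.eigenvalues_mem_spectrum_real i)))

theorem lamMinPos_mem (hM : M.IsHermitian) (h0 : M ≠ 0) : lamMinPos M ∈ spectrum ℝ M \ {0} :=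
  (spectrum_diff_zero_nonempty hM h0).csInf_mem
    (Matrix.finite_real_spectrum.subset Set.sdiff_subset)

theorem lamMinPos_pos (hM : M.PosSemidef) (h0 : M ≠ 0) : 0 < lamMinPos M := by
  have h := lamMinPos_mem hM.isHermitian h0
  exact lt_of_le_of_ne (spectrum_nonneg_of_posSemidef hM h.1) (Ne.symm h.2)

theorem lamMax_mem (hM : M.IsHermitian) (h0 : M ≠ 0) : lamMax M ∈ spectrum ℝ M :=
  ((spectrum_diff_zero_nonempty hM h0).mono Set.sdiff_subset).csSup_mem
    Matrix.finite_real_spectrum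

theorem lamMinPos_le_lamMax (hM : M.IsHermitian) (h0 : M ≠ 0) : lamMinPos M ≤ lamMax M :=
  le_lamMax (lamMinPos_mem hM h0).1

theorem lamMax_pos (hM : M.PosSemidef) (h0 : M ≠ 0) : 0 < lamMax M :=
  (lamMinPos_pos hM h0).trans_le (lamMinPos_le_lamMax hM.isHermitian h0)

theorem one_le_chi (hM : M.PosSemidef) (h0 : M ≠ 0) : 1 ≤ chi M :=
  (one_le_div (lamMinPos_pos hM h0)).2 (lamMinPos_le_lamMax hM.isHermitian h0)

theorem isHermitian_aeval (hM : M.IsHermitian) (P : Polynomial ℝ) :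
    (Polynomial.aeval M P).IsHermitian := by
  have hs : IsSelfAdjoint M := hM
  rw [← cfc_polynomial P M hs]
  exact cfc_predicate _ M

theorem spectrum_aeval (hM : M.IsHermitian) (P : Polynomial ℝ) :
    spectrum ℝ (Polynomial.aeval M P) = P.eval '' spectrum ℝ M := by
  have hs : IsSelfAdjoint M := hM
  rw [← cfc_polynomial P M hs]
  exact cfc_map_spectrum _ M hs P.continuous.continuousOn

theorem posSemidef_aeval (hM : M.IsHermitian) {P : Polynomial ℝ}
    (hP : ∀ x ∈ spectrum ℝ M, 0 ≤ P.eval x) : (Polynomial.aeval M P).PosSemidef := by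
  refine Matrix.posSemidef_iff_isHermitian_and_spectrum_nonneg.2 ⟨isHermitian_aeval hM P, ?_⟩
  rw [spectrum_aeval hM]
  rintro _ ⟨x, hx, rfl⟩
  exact hP x hx

theorem exists_mul_aeval_eq (hM : M.IsHermitian) {P Q : Polynomial ℝ}
    (hPQ : ∀ x ∈ spectrum ℝ M, P.eval x = 0 → Q.eval x = 0) :
    ∃ A : Matrix (Fin m) (Fin m) ℝ, A * Polynomial.aeval M P = Polynomial.aeval M Q := by
  have hs : IsSelfAdjoint M := hM
  have hcont : ∀ f : ℝ → ℝ, ContinuousOn f (spectrum ℝ M) := fun f =>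
    Matrix.finite_real_spectrum.continuousOn f
  refine ⟨cfc (fun x => Q.eval x / P.eval x) M, ?_⟩
  rw [← cfc_polynomial P M hs, ← cfc_polynomial Q M hs,
    ← cfc_mul _ _ M (hcont _) (hcont _)]
  refine cfc_congr fun x hx => ?_
  exact div_mul_cancel_of_imp (hPQ x hx)

theorem aeval_mulVec_eq_zero_iff (hM : M.IsHermitian) {P : Polynomial ℝ}
    (hP : ∀ x ∈ spectrum ℝ M, P.eval x = 0 ↔ x = 0) (v : Fin m → ℝ) :
    (Polynomial.aeval M P).mulVec v = 0 ↔ M.mulVec v = 0 := by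
  obtain ⟨A, hA⟩ := exists_mul_aeval_eq hM (P := P) (Q := Polynomial.X)
    fun x hx h => by rwa [Polynomial.eval_X, ← hP x hx]
  obtain ⟨A', hA'⟩ := exists_mul_aeval_eq hM (P := Polynomial.X) (Q := P)
    fun x hx h => by rwa [Polynomial.eval_X, ← hP x hx] at h
  rw [Polynomial.aeval_X] at hA hA'
  constructor <;> intro h
  · rw [← hA, ← Matrix.mulVec_mulVec, h, Matrix.mulVec_zero]
  · rw [← hA', ← Matrix.mulVec_mulVec, h, Matrix.mulVec_zero]

end Spectrum

section Stacks

variable {m n k d p r : ℕ}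

theorem stack_ext {x y : Stack m n} (h : ∀ i c, x i c = y i c) : x = y :=
  PiLp.ext fun i => PiLp.ext (h i)

theorem kronAct_apply (M : Matrix (Fin m) (Fin m) ℝ) (z : Stack m n) (i : Fin m) :
    kronAct M z i = ∑ j, M i j • z j := rfl

theorem kronAct_apply_apply (M : Matrix (Fin m) (Fin m) ℝ) (z : Stack m n) (i : Fin m)
    (c : Fin n) : kronAct M z i c = M.mulVec (fun j => z j c) i := by
  simp [kronAct_apply, Matrix.mulVec, dotProduct]

theorem continuous_kronAct (M : Matrix (Fin m) (Fin m) ℝ) :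
    Continuous (kronAct M : Stack m n → Stack m n) := by
  unfold kronAct
  fun_prop

/-- The operator `M ⊗ I` on stacked vectors. -/
def kronCLM (n : ℕ) (M : Matrix (Fin m) (Fin m) ℝ) : Stack m n →L[ℝ] Stack m n where
  toFun := kronAct M
  map_add' x y := stack_ext fun i c => by
    simp [kronAct_apply_apply, Matrix.mulVec, dotProduct, mul_add, Finset.sum_add_distrib]
  map_smul' a x := stack_ext fun i c => by
    simp [kronAct_apply_apply, Matrix.mulVec, dotProduct, Finset.mul_sum, mul_left_comm]
  cont := continuous_kronAct M

theorem kronCLM_apply (M : Matrix (Fin m) (Fin m) ℝ) (z : Stack m n) :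
    kronCLM n M z = kronAct M z := rfl

/-- The representation `M ↦ M ⊗ I` of the matrix algebra on stacked vectors, which carries
polynomials in `M` to polynomials in `M ⊗ I` and relates their spectra. -/
def kronHom (n : ℕ) : Matrix (Fin m) (Fin m) ℝ →ₐ[ℝ] (Stack m n →L[ℝ] Stack m n) :=
  AlgHom.ofLinearMap
    { toFun := kronCLM n
      map_add' := fun M M' => ContinuousLinearMap.ext fun z => stack_ext fun i c => by
        simp [kronCLM_apply, kronAct_apply_apply, Matrix.add_mulVec]
      map_smul' := fun a M => ContinuousLinearMap.ext fun z => stack_ext fun i c => by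
        simp [kronCLM_apply, kronAct_apply_apply, Matrix.smul_mulVec] }
    (ContinuousLinearMap.ext fun z => stack_ext fun i c => by
      simp [kronCLM_apply, kronAct_apply_apply])
    (fun M M' => ContinuousLinearMap.ext fun z => stack_ext fun i c => by
      simp [kronCLM_apply, kronAct_apply_apply, ← Matrix.mulVec_mulVec])

theorem kronHom_apply (M : Matrix (Fin m) (Fin m) ℝ) (z : Stack m n) :
    kronHom n M z = kronAct M z := rfl

theorem isSymmetric_kronHom {M : Matrix (Fin m) (Fin m) ℝ} (hM : M.IsHermitian) (n : ℕ) :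
    (kronHom n M).toLinearMap.IsSymmetric := fun x y => by
  simp only [ContinuousLinearMap.coe_coe, kronHom_apply,
    PiLp.inner_apply (𝕜 := ℝ) (f := fun _ : Fin m => Vec n), kronAct_apply, sum_inner,
    inner_sum, real_inner_smul_left, real_inner_smul_right]
  rw [Finset.sum_comm]
  refine Finset.sum_congr rfl fun i _ => Finset.sum_congr rfl fun j _ => ?_
  rw [← hM.apply i j, star_trivial]

theorem adjoint_kronHom {M : Matrix (Fin m) (Fin m) ℝ} (hM : M.IsHermitian) (n : ℕ) :
    (kronHom n M).adjoint = kronHom n M :=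
  ContinuousLinearMap.isSelfAdjoint_iff'.1
    (ContinuousLinearMap.isSelfAdjoint_iff_isSymmetric.2 (isSymmetric_kronHom hM n))

theorem mem_spectrum_of_hasEigenvalue_kronHom {M : Matrix (Fin m) (Fin m) ℝ} {x : ℝ}
    (hx : Module.End.HasEigenvalue (kronHom n M).toLinearMap x) : x ∈ spectrum ℝ M := by
  refine AlgHom.spectrum_apply_subset (kronHom n) M ?_
  rw [← AlgEquiv.spectrum_eq (Module.End.toContinuousLinearMap (𝕜 := ℝ) (Stack m n)).symm]
  exact hx.mem_spectrum

theorem norm_kronHom_le {M : Matrix (Fin m) (Fin m) ℝ} (hM : M.PosSemidef) (z : Stack m n) :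
    ‖kronHom n M z‖ ≤ lamMax M * ‖z‖ :=
  norm_apply_le_of_eigenvalues_le (isSymmetric_kronHom hM.isHermitian n)
    (fun _ hx => (abs_of_nonneg (spectrum_nonneg_of_posSemidef hM
      (mem_spectrum_of_hasEigenvalue_kronHom hx))).trans_le
        (le_lamMax (mem_spectrum_of_hasEigenvalue_kronHom hx)))
    (Real.sSup_nonneg fun _ => spectrum_nonneg_of_posSemidef hM) z

theorem le_norm_kronHom {M : Matrix (Fin m) (Fin m) ℝ} (hM : M.PosSemidef) {z : Stack m n}
    (hz : z ∈ (kronHom n M).kerᗮ) : lamMinPos M * ‖z‖ ≤ ‖kronHom n M z‖ :=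
  le_norm_apply_of_le_eigenvalues (isSymmetric_kronHom hM.isHermitian n)
    (fun _ hx hx0 => (lamMinPos_le (mem_spectrum_of_hasEigenvalue_kronHom hx) hx0).trans
      (le_abs_self _))
    (Real.sInf_nonneg fun _ hx => spectrum_nonneg_of_posSemidef hM hx.1) hz

theorem kronAct_eq_zero_iff (M : Matrix (Fin m) (Fin m) ℝ) (z : Stack m n) :
    kronAct M z = 0 ↔ ∀ c, M.mulVec (fun i => z i c) = 0 := by
  refine ⟨fun h c => funext fun i => ?_, fun h => stack_ext fun i c => ?_⟩
  · rw [← kronAct_apply_apply, h]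
    rfl
  · rw [kronAct_apply_apply, h]
    rfl

theorem blockAct_apply (D : Matrix (Fin k) (Fin n) ℝ) (z : Stack m n) (i : Fin m) :
    blockAct D z i = Matrix.toEuclideanLin D (z i) := rfl

theorem blockAct_zero (D : Matrix (Fin k) (Fin n) ℝ) : blockAct D (0 : Stack m n) = 0 :=
  PiLp.ext fun _ => map_zero _

theorem inner_toEuclideanLin (D : Matrix (Fin k) (Fin n) ℝ) (x : Vec n) (y : Vec k) :
    ⟪y, Matrix.toEuclideanLin D x⟫ = ⟪Matrix.toEuclideanLin D.transpose y, x⟫ := by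
  rw [← Matrix.conjTranspose_eq_transpose_of_trivial,
    Matrix.toEuclideanLin_conjTranspose_eq_adjoint, LinearMap.adjoint_inner_left]

theorem inner_blockAct (D : Matrix (Fin k) (Fin n) ℝ) (x : Stack m n) (y : Stack m k) :
    ⟪y, blockAct D x⟫ = ⟪blockAct D.transpose y, x⟫ := by
  simp only [PiLp.inner_apply (𝕜 := ℝ) (f := fun _ : Fin m => Vec k),
    PiLp.inner_apply (𝕜 := ℝ) (f := fun _ : Fin m => Vec n), blockAct_apply,
    inner_toEuclideanLin]

theorem norm_toEuclideanLin {E : Matrix (Fin d) (Fin r) ℝ} (hE : E.transpose * E = 1)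
    (t : Vec r) : ‖Matrix.toEuclideanLin E t‖ = ‖t‖ := by
  rw [← sq_eq_sq₀ (norm_nonneg _) (norm_nonneg _), ← real_inner_self_eq_norm_sq,
    ← real_inner_self_eq_norm_sq, inner_toEuclideanLin, ← LinearMap.comp_apply,
    ← Matrix.toLpLin_mul_same, hE, Matrix.toLpLin_one, LinearMap.id_apply]

theorem norm_sq_stack (z : Stack m n) : ‖z‖ ^ 2 = ∑ i, ‖z i‖ ^ 2 := PiLp.norm_sq_eq_of_L2 _ z

theorem norm_blockAct {E : Matrix (Fin d) (Fin r) ℝ} (hE : E.transpose * E = 1)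
    (t : Stack m r) : ‖blockAct E t‖ = ‖t‖ := by
  rw [← sq_eq_sq₀ (norm_nonneg _) (norm_nonneg _), norm_sq_stack, norm_sq_stack]
  simp only [blockAct_apply, norm_toEuclideanLin hE]

theorem kronAct_blockAct (M : Matrix (Fin m) (Fin m) ℝ) (E : Matrix (Fin d) (Fin r) ℝ)
    (t : Stack m r) : kronAct M (blockAct E t) = blockAct E (kronAct M t) := by
  refine PiLp.ext fun i => ?_
  simp only [kronAct_apply, blockAct_apply, map_sum, map_smul]

end Stacks

section KernelBasis

variable {m d p r : ℕ} {B : Matrix (Fin p) (Fin d) ℝ} {E : Matrix (Fin d) (Fin r) ℝ}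

theorem IsKernelBasis.blockAct_eq_zero_iff (hE : IsKernelBasis B E) (x : Stack m d) :
    blockAct B x = 0 ↔ ∃ t : Stack m r, blockAct E t = x := by
  constructor
  · intro h
    have hblock : ∀ i, ∃ t, E.mulVec t = (x i).ofLp := fun i =>
      (hE.range_eq _).1 (funext fun c => congrArg (fun y : Stack m p => y i c) h)
    choose t ht using hblock
    exact ⟨WithLp.toLp 2 fun i => WithLp.toLp 2 (t i), stack_ext fun i c => congrFun (ht i) c⟩
  · rintro ⟨t, rfl⟩
    exact stack_ext fun i c => congrFun ((hE.range_eq _).2 ⟨(t i).ofLp, rfl⟩) c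

theorem IsKernelBasis.mem_feasible_iff (hE : IsKernelBasis B E) (W : Matrix (Fin m) (Fin m) ℝ)
    (x : Stack m d) : x ∈ feasible B W ↔ ∃ t : Stack m r, kronAct W t = 0 ∧ blockAct E t = x := by
  constructor
  · rintro ⟨hW, hB⟩
    obtain ⟨t, rfl⟩ := (hE.blockAct_eq_zero_iff x).1 hB
    refine ⟨t, ?_, rfl⟩
    rw [← norm_eq_zero, ← norm_blockAct hE.orthonormal, ← kronAct_blockAct, hW, norm_zero]
  · rintro ⟨t, ht, rfl⟩
    refine ⟨?_, (hE.blockAct_eq_zero_iff _).2 ⟨t, rfl⟩⟩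
    rw [kronAct_blockAct, ht, blockAct_zero]

theorem IsKernelBasis.norm_constraintMap_blockAct (hE : IsKernelBasis B E)
    (W : Matrix (Fin m) (Fin m) ℝ) {γ : ℝ} (hγ : 0 ≤ γ) (t : Stack m r) :
    ‖constraintMap B W γ (blockAct E t)‖ = γ * ‖kronAct W t‖ := by
  rw [constraintMap, (hE.blockAct_eq_zero_iff _).2 ⟨t, rfl⟩, WithLp.norm_toLp_snd, norm_smul,
    Real.norm_of_nonneg hγ, kronAct_blockAct, norm_blockAct hE.orthonormal]

theorem IsKernelBasis.card_add_rank (hE : IsKernelBasis B E) : r + B.rank = d := by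
  have hker : LinearMap.ker B.mulVecLin = LinearMap.range E.mulVecLin := by
    ext x
    exact hE.range_eq x
  have hinj : Function.Injective E.mulVecLin :=
    Function.LeftInverse.injective (g := E.transpose.mulVec) fun t => by
      rw [Matrix.mulVecLin_apply, Matrix.mulVec_mulVec, hE.orthonormal, Matrix.one_mulVec]
  have hdim := LinearMap.finrank_range_add_finrank_ker B.mulVecLin
  rw [hker, LinearMap.finrank_range_of_inj hinj, Module.finrank_fin_fun,
    Module.finrank_fin_fun] at hdim
  rw [Matrix.rank, add_comm, hdim]

end KernelBasis

/-- A matrix that encodes the consensus constraint `x₁ = ⋯ = x_m`: positive semidefinite, with the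
constant vectors as its kernel. Unlike `IsMixing`, it need not be compatible with a graph, so
polynomials in a mixing matrix can qualify. -/
structure IsConsensusMatrix {m : ℕ} (M : Matrix (Fin m) (Fin m) ℝ) : Prop where
  posSemidef : M.PosSemidef
  mulVec_eq_zero_iff : ∀ v : Fin m → ℝ, M.mulVec v = 0 ↔ ∀ i j, v i = v j

section Consensus

variable {m n : ℕ} {M W : Matrix (Fin m) (Fin m) ℝ}

theorem IsMixing.isConsensusMatrix {G : SimpleGraph (Fin m)} (hW : IsMixing G W) :
    IsConsensusMatrix W :=
  ⟨hW.posSemidef, hW.kernel⟩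

theorem IsConsensusMatrix.ne_zero (hM : IsConsensusMatrix M) (hm : 2 ≤ m) : M ≠ 0 := by
  rintro rfl
  have hconst := (hM.mulVec_eq_zero_iff fun i => (i : ℝ)).1 (Matrix.zero_mulVec _)
    ⟨0, by omega⟩ ⟨1, by omega⟩
  simp at hconst

theorem IsConsensusMatrix.kronAct_eq_zero_iff (hM : IsConsensusMatrix M) (z : Stack m n) :
    kronAct M z = 0 ↔ ∀ i j, z i = z j := by
  rw [LocallyDual.kronAct_eq_zero_iff]
  simp only [hM.mulVec_eq_zero_iff]
  exact ⟨fun h i j => PiLp.ext fun c => h c i j, fun h c i j => by rw [h i j]⟩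

theorem IsConsensusMatrix.norm_kronAct_le (hW : IsConsensusMatrix W) (hM : IsConsensusMatrix M)
    (h0 : M ≠ 0) (z : Stack m n) :
    ‖kronAct W z‖ ≤ lamMax W / lamMinPos M * ‖kronAct M z‖ := by
  set u := (kronHom n M).kerᗮ.starProjection z
  have hMu : kronHom n M u = kronHom n M z := apply_starProjection_orthogonal_ker _ z
  have hWu : kronHom n W u = kronHom n W z := by
    rw [← sub_eq_zero, ← map_sub] at hMu ⊢
    exact (hW.kronAct_eq_zero_iff _).2 ((hM.kronAct_eq_zero_iff _).1 hMu)
  have hlower : lamMinPos M * ‖u‖ ≤ ‖kronHom n M u‖ :=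
    le_norm_kronHom hM.posSemidef (Submodule.starProjection_apply_mem _ z)
  have hpos := lamMinPos_pos hM.posSemidef h0
  calc ‖kronAct W z‖ = ‖kronHom n W u‖ := by rw [hWu, kronHom_apply]
    _ ≤ lamMax W * ‖u‖ := norm_kronHom_le hW.posSemidef u
    _ ≤ lamMax W * (‖kronHom n M u‖ / lamMinPos M) := by
      have : 0 ≤ lamMax W := Real.sSup_nonneg fun _ => spectrum_nonneg_of_posSemidef hW.posSemidef
      gcongr
      rwa [le_div_iff₀' hpos]
    _ = lamMax W / lamMinPos M * ‖kronAct M z‖ := by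
      rw [hMu, kronHom_apply]
      ring

end Consensus

section SeparableSums

variable {m n : ℕ} {c : ℝ} {g : Fin m → Vec n → ℝ}

theorem hasGradientAt_sepSum (hg : ∀ i, Differentiable ℝ (g i)) (x : Stack m n) :
    HasGradientAt (sepSum g) (WithLp.toLp 2 fun i => gradient (g i) (x i)) x := by
  rw [hasGradientAt_iff_hasFDerivAt]
  have h : HasFDerivAt (fun x : Stack m n => ∑ i, g i (x i)) (∑ i, (InnerProductSpace.toDual ℝ
      (Vec n) (gradient (g i) (x i))).comp (PiLp.proj 2 (fun _ : Fin m => Vec n) i)) x :=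
    HasFDerivAt.fun_sum fun i _ => (hg i (x i)).hasGradientAt.hasFDerivAt.comp x
      (PiLp.proj (𝕜 := ℝ) 2 (fun _ : Fin m => Vec n) i).hasFDerivAt
  refine h.congr_fderiv ?_
  ext y
  simp [PiLp.inner_apply (𝕜 := ℝ) (f := fun _ : Fin m => Vec n)]

theorem inner_gradient_sepSum (hg : ∀ i, Differentiable ℝ (g i)) (x y : Stack m n) :
    ⟪gradient (sepSum g) x, y⟫ = ∑ i, ⟪gradient (g i) (x i), y i⟫ := by
  rw [(hasGradientAt_sepSum hg x).gradient,
    PiLp.inner_apply (𝕜 := ℝ) (f := fun _ : Fin m => Vec n)]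

theorem stronglyConvexWith_sepSum (hg : ∀ i, StronglyConvexWith c (g i)) :
    StronglyConvexWith c (sepSum g) := by
  have hd : ∀ i, Differentiable ℝ (g i) := fun i => (hg i).1
  refine ⟨fun x => (hasGradientAt_sepSum hd x).differentiableAt, fun x y => ?_⟩
  rw [inner_gradient_sepSum hd, norm_sq_stack, Finset.mul_sum]
  simp only [sepSum, ← Finset.sum_add_distrib]
  exact Finset.sum_le_sum fun i _ => (hg i).2 (x i) (y i)

theorem smoothWith_sepSum (hg : ∀ i, SmoothWith c (g i)) : SmoothWith c (sepSum g) := by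
  have hd : ∀ i, Differentiable ℝ (g i) := fun i => (hg i).1
  refine ⟨fun x => (hasGradientAt_sepSum hd x).differentiableAt, fun x y => ?_⟩
  rw [inner_gradient_sepSum hd, norm_sq_stack, Finset.mul_sum]
  simp only [sepSum, ← Finset.sum_add_distrib]
  exact Finset.sum_le_sum fun i _ => (hg i).2 (x i) (y i)

theorem gradient_conjugate_sepSum (hg : ∀ i, StronglyConvexWith c (g i)) (hc : 0 < c)
    (z : Stack m n) : gradient (conjugate (sepSum g)) z =
      WithLp.toLp 2 fun i => gradient (conjugate (g i)) (z i) := by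
  symm
  rw [← (stronglyConvexWith_sepSum hg).isMaxOn_iff_eq_gradient_conjugate hc,
    (stronglyConvexWith_sepSum hg).isMaxOn_iff_gradient_eq hc.le,
    (hasGradientAt_sepSum (fun i => (hg i).1) _).gradient]
  exact PiLp.ext fun i => (hg i).gradient_gradient_conjugate hc (z i)

theorem dualObj_eq_comp (g : Fin m → Vec n → ℝ) (M : Matrix (Fin m) (Fin m) ℝ) :
    dualObj g M = conjugate (sepSum g) ∘ kronHom n M := rfl

theorem exists_dualObj_minimizer (hg : ∀ i, StronglyConvexWith c (g i)) (hc : 0 < c)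
    (M : Matrix (Fin m) (Fin m) ℝ) : ∃ z, ∀ z', dualObj g M z ≤ dualObj g M z' := by
  obtain ⟨z, _, -, -, hz⟩ := (stronglyConvexWith_sepSum hg).exists_dual_minimizer hc (kronHom n M)
  exact ⟨z, hz⟩

end SeparableSums

section Reparametrization

variable {m d p r : ℕ} {c : ℝ} {f : Fin m → Vec d → ℝ} {B : Matrix (Fin p) (Fin d) ℝ}
  {E : Matrix (Fin d) (Fin r) ℝ}

theorem reparam_eq_comp (f : Fin m → Vec d → ℝ) (E : Matrix (Fin d) (Fin r) ℝ) (i : Fin m) :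
    reparam f E i = f i ∘ (Matrix.toEuclideanLin E).toContinuousLinearMap := rfl

theorem stronglyConvexWith_reparam (hf : ∀ i, StronglyConvexWith c (f i))
    (hE : E.transpose * E = 1) (i : Fin m) : StronglyConvexWith c (reparam f E i) := by
  rw [reparam_eq_comp]
  exact (hf i).comp_isometry (norm_toEuclideanLin hE)

theorem smoothWith_reparam (hf : ∀ i, SmoothWith c (f i)) (hE : E.transpose * E = 1) (i : Fin m) :
    SmoothWith c (reparam f E i) := by
  rw [reparam_eq_comp]
  exact (hf i).comp_isometry (norm_toEuclideanLin hE)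

theorem IsKernelBasis.nontrivial (hE : IsKernelBasis B E) (hB : ∃ x ≠ 0, B.mulVec x = 0) :
    Nontrivial (Vec r) := by
  obtain ⟨x, hx, hBx⟩ := hB
  obtain ⟨t, rfl⟩ := (hE.range_eq x).1 hBx
  refine nontrivial_of_ne (WithLp.toLp 2 t) 0 fun ht => hx ?_
  rw [(WithLp.toLp_eq_zero 2).1 ht, Matrix.mulVec_zero]

theorem IsKernelBasis.image_feasible (hE : IsKernelBasis B E) (W : Matrix (Fin m) (Fin m) ℝ)
    (f : Fin m → Vec d → ℝ) :
    sepSum f '' feasible B W = sepSum (reparam f E) '' {t | kronAct W t = 0} := by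
  ext y
  simp only [Set.mem_image, hE.mem_feasible_iff]
  constructor
  · rintro ⟨_, ⟨t, ht, rfl⟩, rfl⟩
    exact ⟨t, ht, rfl⟩
  · rintro ⟨t, ht, rfl⟩
    exact ⟨_, ⟨t, ht, rfl⟩, rfl⟩

theorem IsKernelBasis.isLUB_conjugate (hE : IsKernelBasis B E)
    (hf : ∀ i, StronglyConvexWith c (reparam f E i)) (hc : 0 < c) (v : Stack m d) :
    IsLUB ((fun x => inner ℝ v x - sepSum f x) '' {x | blockAct B x = 0})
      (conjugate (sepSum (reparam f E)) (blockAct E.transpose v)) := by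
  have hker : {x : Stack m d | blockAct B x = 0} = Set.range (blockAct E) :=
    Set.ext hE.blockAct_eq_zero_iff
  rw [hker, ← Set.range_comp]
  convert (stronglyConvexWith_sepSum hf).isLUB_conjugate hc (blockAct E.transpose v) using 3 with t
  exact congrArg (· - sepSum f (blockAct E t)) (inner_blockAct E t v)

theorem IsKernelBasis.isLeast_neg_dualObj {M W : Matrix (Fin m) (Fin m) ℝ}
    (hE : IsKernelBasis B E) (hW : IsConsensusMatrix W) (hM : IsConsensusMatrix M)
    (hf : ∀ i, StronglyConvexWith c (reparam f E i)) (hc : 0 < c) {z : Stack m r}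
    (hz : ∀ z', dualObj (reparam f E) M z ≤ dualObj (reparam f E) M z') :
    IsLeast (sepSum f '' feasible B W) (-dualObj (reparam f E) M z) := by
  have hker : {t : Stack m r | kronAct W t = 0} = {t | (kronHom r M).adjoint t = 0} := by
    ext t
    rw [adjoint_kronHom hM.posSemidef.isHermitian]
    exact (hW.kronAct_eq_zero_iff t).trans (hM.kronAct_eq_zero_iff t).symm
  rw [hE.image_feasible, hker]
  exact (stronglyConvexWith_sepSum hf).isLeast_neg_dual hc hz

end Reparametrization

namespace Counted

variable {α β : Type}

theorem val_pure (a : α) : (pure a : Counted α).val = a := rfl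

theorem oracleCalls_pure (a : α) : (pure a : Counted α).oracleCalls = 0 := rfl

theorem communications_pure (a : α) : (pure a : Counted α).communications = 0 := rfl

theorem val_bind (c : Counted α) (k : α → Counted β) : (c >>= k).val = (k c.val).val := rfl

theorem oracleCalls_bind (c : Counted α) (k : α → Counted β) :
    (c >>= k).oracleCalls = c.oracleCalls + (k c.val).oracleCalls := rfl

theorem communications_bind (c : Counted α) (k : α → Counted β) :
    (c >>= k).communications = c.communications + (k c.val).communications := rfl

end Counted

section Communication

variable {m r : ℕ} {G : SimpleGraph (Fin m)} {W : Matrix (Fin m) (Fin m) ℝ}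

theorem gossip_val (hW : IsMixing G W) (z : Stack m r) : (gossip G W z).val = kronAct W z := by
  classical
  refine PiLp.ext fun i => ?_
  have hoff : ∑ j, (if G.Adj i j then W i j • z j else 0) =
      ∑ j ∈ Finset.univ.erase i, W i j • z j := by
    rw [← Finset.add_sum_erase _ _ (Finset.mem_univ i), if_neg G.irrefl, zero_add]
    refine Finset.sum_congr rfl fun j hj => ?_
    split_ifs with hadj
    · rfl
    · rw [hW.compatible i j (Finset.ne_of_mem_erase hj).symm hadj, zero_smul]
  rw [kronAct_apply, ← Finset.add_sum_erase _ _ (Finset.mem_univ i), ← hoff]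
  simp only [gossip]

theorem hornerLoop_val (hW : IsMixing G W) (P : Polynomial ℝ) (v : Stack m r) (k : ℕ)
    (y : Stack m r) : (hornerLoop G W P v k y).val =
      kronHom r (W ^ k) y + kronHom r (∑ j ∈ Finset.range k, P.coeff j • W ^ j) v := by
  induction k generalizing y with
  | zero => simp [hornerLoop, Counted.val_pure]
  | succ k ih =>
    rw [hornerLoop, Counted.val_bind, ih, gossip_val hW, ← kronHom_apply, pow_succ,
      Finset.sum_range_succ]
    rw [map_add, map_mul, mul_apply_eq_comp]
    simp only [map_add, map_smul, add_apply, smul_apply]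
    abel

theorem hornerLoop_communications (P : Polynomial ℝ) (v : Stack m r) (k : ℕ) (y : Stack m r) :
    (hornerLoop G W P v k y).communications = k := by
  induction k generalizing y with
  | zero => rfl
  | succ k ih => rw [hornerLoop, Counted.communications_bind, ih, gossip, add_comm]

theorem hornerLoop_oracleCalls (P : Polynomial ℝ) (v : Stack m r) (k : ℕ) (y : Stack m r) :
    (hornerLoop G W P v k y).oracleCalls = 0 := by
  induction k generalizing y with
  | zero => rfl
  | succ k ih => rw [hornerLoop, Counted.oracleCalls_bind, ih, gossip]

theorem polyGossip_val (hW : IsMixing G W) (P : Polynomial ℝ) (v : Stack m r) :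
    (polyGossip G W P v).val = kronAct (Polynomial.aeval W P) v := by
  rw [polyGossip, hornerLoop_val hW, Polynomial.aeval_eq_sum_range, Finset.sum_range_succ,
    ← kronHom_apply, map_add, add_comm]
  simp only [map_smul, add_apply, smul_apply, Polynomial.leadingCoeff]

theorem polyGossip_communications (P : Polynomial ℝ) (v : Stack m r) :
    (polyGossip G W P v).communications = P.natDegree :=
  hornerLoop_communications P v _ _

theorem polyGossip_oracleCalls (P : Polynomial ℝ) (v : Stack m r) :
    (polyGossip G W P v).oracleCalls = 0 :=
  hornerLoop_oracleCalls P v _ _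

end Communication

section DualGradient

variable {m r : ℕ} {G : SimpleGraph (Fin m)} {W : Matrix (Fin m) (Fin m) ℝ} {h : Fin m → Vec r → ℝ}
  {c : ℝ}

theorem dualOracle_val (hh : ∀ i, StronglyConvexWith c (h i)) (hc : 0 < c) (z : Stack m r) :
    (dualOracle h z).val = gradient (conjugate (sepSum h)) z :=
  (gradient_conjugate_sepSum hh hc z).symm

theorem dualGrad_val (hW : IsMixing G W) (P : Polynomial ℝ)
    (hh : ∀ i, StronglyConvexWith c (h i)) (hc : 0 < c) (z : Stack m r) :
    (dualGrad G W P h z).val = gradient (dualObj h (Polynomial.aeval W P)) z := by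
  have hherm := isHermitian_aeval hW.posSemidef.isHermitian P
  rw [dualGrad, Counted.val_bind, Counted.val_bind, polyGossip_val hW, dualOracle_val hh hc,
    polyGossip_val hW, dualObj_eq_comp,
    gradient_comp ((stronglyConvexWith_sepSum hh).differentiable_conjugate hc),
    adjoint_kronHom hherm, kronHom_apply, kronHom_apply]

theorem dualGrad_oracleCalls (P : Polynomial ℝ) (z : Stack m r) :
    (dualGrad G W P h z).oracleCalls = 1 := by
  simp only [dualGrad, Counted.oracleCalls_bind, polyGossip_oracleCalls, dualOracle]

theorem dualGrad_communications (P : Polynomial ℝ) (z : Stack m r) :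
    (dualGrad G W P h z).communications = 2 * P.natDegree := by
  simp only [dualGrad, Counted.communications_bind, polyGossip_communications, dualOracle]
  ring

end DualGradient

section FastGradientLoop

variable {m r : ℕ} {grad : Stack m r → Counted (Stack m r)} {a : ℕ}

theorem fastGradientLoop_val (grad : Stack m r → Counted (Stack m r)) (η β : ℝ) (N : ℕ)
    (w z : Stack m r) : (fastGradientLoop grad η β N w z).val =
      fastGradientIter (fun y => (grad y).val) η β N w z := by
  induction N generalizing w z with
  | zero => rfl
  | succ _ ih => exact ih _ _

theorem fastGradientLoop_oracleCalls (hg : ∀ z, (grad z).oracleCalls = a) (η β : ℝ) (N : ℕ)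
    (w z : Stack m r) : (fastGradientLoop grad η β N w z).oracleCalls = N * a := by
  induction N generalizing w z with
  | zero => exact (zero_mul a).symm
  | succ N ih => rw [fastGradientLoop, Counted.oracleCalls_bind, ih, hg, Nat.succ_mul, add_comm]

theorem fastGradientLoop_communications (hg : ∀ z, (grad z).communications = a) (η β : ℝ)
    (N : ℕ) (w z : Stack m r) : (fastGradientLoop grad η β N w z).communications = N * a := by
  induction N generalizing w z with
  | zero => exact (zero_mul a).symm
  | succ N ih => rw [fastGradientLoop, Counted.communications_bind, ih, hg, Nat.succ_mul, add_comm]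

end FastGradientLoop

section LocallyDualMethod

variable {m d r : ℕ} {G : SimpleGraph (Fin m)} {W : Matrix (Fin m) (Fin m) ℝ}
  {f : Fin m → Vec d → ℝ} {E : Matrix (Fin d) (Fin r) ℝ} {P : Polynomial ℝ} {μ L : ℝ}

theorem locallyDual_val (hW : IsMixing G W) (hμ : 0 < μ)
    (hh : ∀ i, StronglyConvexWith μ (reparam f E i)) (z₀ : Stack m r) (N : ℕ) :
    (locallyDual G W P f E μ L z₀ N).val =
      let M := Polynomial.aeval W P
      let s := √(L / μ) * chi M
      blockAct E (gradient (conjugate (sepSum (reparam f E))) (kronAct M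
        (fastGradientIter (gradient (dualObj (reparam f E) M)) (μ / lamMax M ^ 2)
          ((s - 1) / (s + 1)) N z₀ z₀))) := by
  simp only [locallyDual, Counted.val_bind, Counted.val_pure, polyGossip_val hW,
    dualOracle_val hh hμ, fastGradientLoop_val, dualGrad_val hW P hh hμ]

theorem locallyDual_oracleCalls (z₀ : Stack m r) (N : ℕ) :
    (locallyDual G W P f E μ L z₀ N).oracleCalls = N + 1 := by
  simp only [locallyDual, Counted.oracleCalls_bind, Counted.oracleCalls_pure,
    fastGradientLoop_oracleCalls (dualGrad_oracleCalls P), polyGossip_oracleCalls, dualOracle]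
  ring

theorem locallyDual_communications (z₀ : Stack m r) (N : ℕ) :
    (locallyDual G W P f E μ L z₀ N).communications = (2 * N + 1) * P.natDegree := by
  simp only [locallyDual, Counted.communications_bind, Counted.communications_pure,
    fastGradientLoop_communications (dualGrad_communications P), polyGossip_communications,
    dualOracle]
  ring

end LocallyDualMethod

section Chebyshev

open Polynomial.Chebyshev

theorem le_eval_T_succ_sub (k : ℕ) {x : ℝ} (hx : 1 ≤ x) :
    (2 * k + 1) * (x - 1) ≤ (T ℝ (k + 1)).eval x - (T ℝ k).eval x := by
  induction k with
  | zero => simp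
  | succ k ih =>
    have hrec : (T ℝ (k + 2)).eval x = 2 * x * (T ℝ (k + 1)).eval x - (T ℝ k).eval x := by
      simp [T_add_two]
    have hone := mul_le_mul_of_nonneg_right (one_le_eval_T_real (k + 1) hx) (sub_nonneg.2 hx)
    push_cast
    rw [add_assoc, one_add_one_eq_two, hrec]
    linarith

theorem one_add_sq_mul_le_eval_T (k : ℕ) {x : ℝ} (hx : 1 ≤ x) :
    1 + (k : ℝ) ^ 2 * (x - 1) ≤ (T ℝ k).eval x := by
  induction k with
  | zero => simp
  | succ k ih =>
    have hstep := le_eval_T_succ_sub k hx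
    push_cast
    linarith

variable {m : ℕ} {W : Matrix (Fin m) (Fin m) ℝ}

/-- The degree `K = ⌈√(2χ(W))⌉` of the Chebyshev polynomial in `chebPoly`. -/
def chebDegree (W : Matrix (Fin m) (Fin m) ℝ) : ℕ := ⌈√(2 * chi W)⌉₊

/-- The affine map `θ` of `chebPoly`, which sends `[λ_min⁺(W) / 2, λ_max(W)]` onto `[-1, 1]`. -/
def chebMap (W : Matrix (Fin m) (Fin m) ℝ) (x : ℝ) : ℝ :=
  (lamMax W + lamMinPos W / 2 - 2 * x) / (lamMax W - lamMinPos W / 2)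

theorem eval_chebPoly (W : Matrix (Fin m) (Fin m) ℝ) (x : ℝ) :
    (chebPoly W).eval x = 1 -
      (T ℝ (chebDegree W)).eval (chebMap W x) / (T ℝ (chebDegree W)).eval (chebMap W 0) := by
  have hθ : chebMap W x = (lamMax W + lamMinPos W / 2) / (lamMax W - lamMinPos W / 2) -
      2 / (lamMax W - lamMinPos W / 2) * x := by
    rw [chebMap, sub_div, mul_div_right_comm]
  have hθ0 : chebMap W 0 = (lamMax W + lamMinPos W / 2) / (lamMax W - lamMinPos W / 2) := by
    rw [chebMap, mul_zero, sub_zero]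
  rw [hθ, hθ0, div_eq_inv_mul]
  simp [chebPoly, chebDegree, Polynomial.eval_comp]

theorem natDegree_chebPoly_le (W : Matrix (Fin m) (Fin m) ℝ) :
    (chebPoly W).natDegree ≤ chebDegree W := by
  refine (Polynomial.natDegree_sub_le _ _).trans (max_le (by simp) ?_)
  refine (Polynomial.natDegree_C_mul_le _ _).trans (Polynomial.natDegree_comp_le.trans ?_)
  rw [natDegree_T, Int.natAbs_natCast]
  refine mul_le_of_le_one_right (Nat.zero_le _) ?_
  refine (Polynomial.natDegree_sub_le _ _).trans (max_le (by simp) ?_)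
  exact (Polynomial.natDegree_C_mul_le _ _).trans Polynomial.natDegree_X_le

theorem natDegree_chebPoly_le_sqrt (hW : W.PosSemidef) (h0 : W ≠ 0) :
    ((chebPoly W).natDegree : ℝ) ≤ 3 * √(chi W) := by
  have hχ : 1 ≤ chi W := one_le_chi hW h0
  have hsqrt : √(2 * chi W) ≤ 2 * √(chi W) := by
    rw [Real.sqrt_le_left (by positivity), mul_pow, Real.sq_sqrt (by linarith)]
    linarith
  calc ((chebPoly W).natDegree : ℝ) ≤ chebDegree W := by exact_mod_cast natDegree_chebPoly_le W
    _ ≤ √(2 * chi W) + 1 := (Nat.ceil_lt_add_one (by positivity)).le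
    _ ≤ 3 * √(chi W) := by linarith [Real.one_le_sqrt.2 hχ]

theorem two_mul_chi_le_chebDegree_sq (W : Matrix (Fin m) (Fin m) ℝ) :
    2 * chi W ≤ (chebDegree W : ℝ) ^ 2 :=
  (Real.sqrt_le_left (by positivity)).1 (Nat.le_ceil _)

theorem inv_chi_le_chebMap_zero_sub_one (hW : W.PosSemidef) (h0 : W ≠ 0) :
    (chi W)⁻¹ ≤ chebMap W 0 - 1 := by
  have hl := lamMinPos_pos hW h0
  have hb := lamMinPos_le_lamMax hW.isHermitian h0
  have hba : 0 < lamMax W - lamMinPos W / 2 := by linarith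
  rw [chebMap, div_sub_one hba.ne', chi, inv_div]
  exact div_le_div₀ (by linarith) (by linarith) hba (by linarith)

theorem three_le_eval_T_chebMap_zero (hW : W.PosSemidef) (h0 : W ≠ 0) :
    3 ≤ (T ℝ (chebDegree W)).eval (chebMap W 0) := by
  have hχ : 0 < chi W := zero_lt_one.trans_le (one_le_chi hW h0)
  have hgap := inv_chi_le_chebMap_zero_sub_one hW h0
  calc (3 : ℝ) = 1 + 2 * chi W * (chi W)⁻¹ := by
        rw [mul_assoc, mul_inv_cancel₀ hχ.ne']
        norm_num
    _ ≤ 1 + (chebDegree W : ℝ) ^ 2 * (chebMap W 0 - 1) := by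
        gcongr
        exact two_mul_chi_le_chebDegree_sq W
    _ ≤ (T ℝ (chebDegree W)).eval (chebMap W 0) :=
        one_add_sq_mul_le_eval_T _ (sub_nonneg.1 ((inv_pos.2 hχ).le.trans hgap))

theorem abs_chebMap_le_one {x : ℝ} (hb : lamMinPos W / 2 < lamMax W)
    (hx : x ∈ Set.Icc (lamMinPos W / 2) (lamMax W)) : |chebMap W x| ≤ 1 := by
  have hba : 0 < lamMax W - lamMinPos W / 2 := sub_pos.2 hb
  rw [chebMap, abs_div, abs_of_pos hba, div_le_one hba, abs_le]
  constructor <;> linarith [hx.1, hx.2]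

theorem eval_chebPoly_zero (hW : W.PosSemidef) (h0 : W ≠ 0) : (chebPoly W).eval 0 = 0 := by
  have hτ := three_le_eval_T_chebMap_zero hW h0
  rw [eval_chebPoly, div_self (by linarith), sub_self]

theorem eval_chebPoly_mem_Icc (hW : W.PosSemidef) (h0 : W ≠ 0) {x : ℝ} (hx : x ∈ spectrum ℝ W)
    (hx0 : x ≠ 0) : (chebPoly W).eval x ∈ Set.Icc (2 / 3) (4 / 3) := by
  have hl := lamMinPos_pos hW h0
  have hlx := lamMinPos_le hx hx0
  have hxb := le_lamMax hx
  have hτ := three_le_eval_T_chebMap_zero hW h0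
  have hnum : |(T ℝ (chebDegree W)).eval (chebMap W x)| ≤ 1 :=
    abs_eval_T_real_le_one _ (abs_chebMap_le_one (by linarith) ⟨by linarith, hxb⟩)
  have hratio : |(T ℝ (chebDegree W)).eval (chebMap W x) /
      (T ℝ (chebDegree W)).eval (chebMap W 0)| ≤ 1 / 3 := by
    rw [abs_div, abs_of_pos (by linarith : 0 < (T ℝ (chebDegree W)).eval (chebMap W 0))]
    exact div_le_div₀ zero_le_one hnum three_pos hτ
  rw [eval_chebPoly]
  constructor <;> linarith [abs_le.1 hratio]

theorem spectrum_aeval_chebPoly_subset (hW : W.PosSemidef) (h0 : W ≠ 0) :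
    spectrum ℝ (Polynomial.aeval W (chebPoly W)) ⊆ {0} ∪ Set.Icc (2 / 3) (4 / 3) := by
  rw [spectrum_aeval hW.isHermitian]
  rintro _ ⟨x, hx, rfl⟩
  by_cases hx0 : x = 0
  · subst hx0
    exact Or.inl (eval_chebPoly_zero hW h0)
  · exact Or.inr (eval_chebPoly_mem_Icc hW h0 hx hx0)

theorem aeval_chebPoly_mulVec_eq_zero_iff (hW : W.PosSemidef) (h0 : W ≠ 0) (v : Fin m → ℝ) :
    (Polynomial.aeval W (chebPoly W)).mulVec v = 0 ↔ W.mulVec v = 0 := by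
  refine aeval_mulVec_eq_zero_iff hW.isHermitian (fun x hx => ⟨fun h => ?_, ?_⟩) v
  · by_contra hx0
    linarith [(eval_chebPoly_mem_Icc hW h0 hx hx0).1]
  · rintro rfl
    exact eval_chebPoly_zero hW h0

theorem aeval_chebPoly_ne_zero (hW : W.PosSemidef) (h0 : W ≠ 0) :
    Polynomial.aeval W (chebPoly W) ≠ 0 := by
  intro h
  refine h0 (Matrix.ext_of_mulVec_single fun i => ?_)
  rw [(aeval_chebPoly_mulVec_eq_zero_iff hW h0 _).1 (by rw [h, Matrix.zero_mulVec]),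
    Matrix.zero_mulVec]

theorem posSemidef_aeval_chebPoly (hW : W.PosSemidef) (h0 : W ≠ 0) :
    (Polynomial.aeval W (chebPoly W)).PosSemidef := by
  refine posSemidef_aeval hW.isHermitian fun x hx => ?_
  by_cases hx0 : x = 0
  · rw [hx0, eval_chebPoly_zero hW h0]
  · linarith [(eval_chebPoly_mem_Icc hW h0 hx hx0).1]

theorem IsConsensusMatrix.aeval_chebPoly (hW : IsConsensusMatrix W) (h0 : W ≠ 0) :
    IsConsensusMatrix (Polynomial.aeval W (chebPoly W)) where
  posSemidef := posSemidef_aeval_chebPoly hW.posSemidef h0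
  mulVec_eq_zero_iff v :=
    (aeval_chebPoly_mulVec_eq_zero_iff hW.posSemidef h0 v).trans (hW.mulVec_eq_zero_iff v)

theorem two_thirds_le_lamMinPos_aeval_chebPoly (hW : W.PosSemidef) (h0 : W ≠ 0) :
    2 / 3 ≤ lamMinPos (Polynomial.aeval W (chebPoly W)) := by
  obtain ⟨hmem, hne⟩ := lamMinPos_mem (posSemidef_aeval_chebPoly hW h0).isHermitian
    (aeval_chebPoly_ne_zero hW h0)
  exact ((spectrum_aeval_chebPoly_subset hW h0 hmem).resolve_left hne).1

theorem lamMax_aeval_chebPoly_le (hW : W.PosSemidef) (h0 : W ≠ 0) :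
    lamMax (Polynomial.aeval W (chebPoly W)) ≤ 4 / 3 := by
  have hM := posSemidef_aeval_chebPoly hW h0
  have hM0 := aeval_chebPoly_ne_zero hW h0
  exact ((spectrum_aeval_chebPoly_subset hW h0 (lamMax_mem hM.isHermitian hM0)).resolve_left
    (lamMax_pos hM hM0).ne').2

theorem chi_aeval_chebPoly_le (hW : W.PosSemidef) (h0 : W ≠ 0) :
    chi (Polynomial.aeval W (chebPoly W)) ≤ 2 := by
  have hmin := two_thirds_le_lamMinPos_aeval_chebPoly hW h0
  have hmax := lamMax_aeval_chebPoly_le hW h0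
  rw [chi, div_le_iff₀ (by linarith)]
  linarith

end Chebyshev

section Complexity

theorem half_le_log {Θ ε : ℝ} (hΘ : 0 ≤ Θ) (hε : 0 < ε) (hε1 : ε ≤ 1) :
    1 / 2 ≤ Real.log ((2 + Θ) / ε) := by
  have htwo : 2 ≤ (2 + Θ) / ε := by
    rw [le_div_iff₀ hε]
    linarith
  linarith [Real.log_le_log two_pos htwo, Real.log_two_gt_d9]

theorem mul_exp_le_of_log_le {s Θ ε x : ℝ} (j : ℕ) (hs : 0 < s) (hΘ : 0 ≤ Θ) (hε : 0 < ε)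
    (hε1 : ε ≤ 1) (hx : 2 * (j + 1) * (s * Real.log ((2 + Θ) / ε)) ≤ x) :
    2 ^ j * Θ * Real.exp (-(x / (2 * s))) ≤ ε := by
  set u := (2 + Θ) / ε with hu
  have hu2 : 2 ≤ u := by
    rw [hu, le_div_iff₀ hε]
    linarith
  have : 0 < u := by linarith
  have hΘu : Θ ≤ ε * u := by
    rw [hu, mul_div_cancel₀ _ hε.ne']
    linarith
  have hlog : Real.log (u ^ (j + 1)) ≤ x / (2 * s) := by
    rw [Real.log_pow, le_div_iff₀ (by positivity)]
    push_cast
    linarith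
  have hexp : Real.exp (-(x / (2 * s))) ≤ (u ^ (j + 1))⁻¹ := by
    rw [Real.exp_neg]
    exact inv_anti₀ (by positivity) ((Real.log_le_iff_le_exp (by positivity)).1 hlog)
  calc 2 ^ j * Θ * Real.exp (-(x / (2 * s))) ≤ u ^ j * (ε * u) * (u ^ (j + 1))⁻¹ := by gcongr
    _ = ε := by
      rw [pow_succ]
      field_simp

variable {m d p r : ℕ} {G : SimpleGraph (Fin m)} {W : Matrix (Fin m) (Fin m) ℝ}
  {P : Polynomial ℝ} {B : Matrix (Fin p) (Fin d) ℝ} {E : Matrix (Fin d) (Fin r) ℝ}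
  {f : Fin m → Vec d → ℝ} {μ L R γ ε : ℝ} {z₀ zs : Stack m r}

theorem one_le_sqrt_div (hμ : 0 < μ) (hμL : μ ≤ L) : 1 ≤ √(L / μ) :=
  Real.one_le_sqrt.2 ((one_le_div hμ).2 hμL)

theorem locallyDual_primal_accuracy (hW : IsMixing G W) {M : Matrix (Fin m) (Fin m) ℝ}
    (hPM : Polynomial.aeval W P = M) (hM : IsConsensusMatrix M) (hM0 : M ≠ 0)
    (hE : IsKernelBasis B E) (hμ : 0 < μ) (hμL : μ ≤ L)
    (hf : ∀ i, StronglyConvexWith μ (reparam f E i)) (hf' : ∀ i, SmoothWith L (reparam f E i))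
    (hzs : ∀ z, dualObj (reparam f E) M zs ≤ dualObj (reparam f E) M z) (hR : ‖zs‖ ≤ R)
    (hR₀ : ‖z₀ - zs‖ ≤ R) (hγ : 0 ≤ γ) (N : ℕ) :
    let x := (locallyDual G W P f E μ L z₀ N).val
    let s := √(L / μ) * chi M
    let δ := Real.exp (-(N / (2 * s)))
    (∀ y ∈ feasible B W, sepSum f x - sepSum f y ≤ 4 * (s * (lamMax M ^ 2 / μ) * R ^ 2) * δ) ∧
      ‖constraintMap B W γ x‖ ≤
        γ * (lamMax W / lamMinPos M * (2 * (lamMax M ^ 2 / μ * R) * δ)) := by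
  intro x s δ
  have hself := adjoint_kronHom hM.posSemidef.isHermitian r
  obtain ⟨hgap, hres⟩ := fastGradientIter_primal_accuracy (stronglyConvexWith_sepSum hf) hμ
    (smoothWith_sepSum hf') (hμ.trans_le hμL) (lamMinPos_pos hM.posSemidef hM0)
    (lamMax_pos hM.posSemidef hM0) (fun _ => le_norm_kronHom hM.posSemidef)
    (norm_kronHom_le hM.posSemidef) rfl
    (one_le_mul_of_one_le_of_one_le (one_le_sqrt_div hμ hμL) (one_le_chi hM.posSemidef hM0))
    hzs hR hR₀ N
  have hx := locallyDual_val (P := P) (L := L) hW hμ hf z₀ N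
  rw [hPM] at hx
  rw [hself] at hres
  refine ⟨fun y hy => ?_, ?_⟩
  · obtain ⟨u, hu, rfl⟩ := (hE.mem_feasible_iff W y).1 hy
    rw [show x = _ from hx]
    refine hgap u ?_
    rw [hself]
    exact (hM.kronAct_eq_zero_iff u).2 ((hW.isConsensusMatrix.kronAct_eq_zero_iff u).1 hu)
  · have hρ : 0 ≤ lamMax W / lamMinPos M :=
      div_nonneg (Real.sSup_nonneg fun _ => spectrum_nonneg_of_posSemidef hW.posSemidef)
        (lamMinPos_pos hM.posSemidef hM0).le
    rw [show x = _ from hx, hE.norm_constraintMap_blockAct W hγ]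
    exact mul_le_mul_of_nonneg_left ((hW.isConsensusMatrix.norm_kronAct_le hM hM0 _).trans
      (mul_le_mul_of_nonneg_left hres hρ)) hγ

theorem locallyDual_isAccurate (hW : IsMixing G W) {M : Matrix (Fin m) (Fin m) ℝ}
    (hPM : Polynomial.aeval W P = M) (hM : IsConsensusMatrix M) (hM0 : M ≠ 0)
    (hE : IsKernelBasis B E) (hμ : 0 < μ) (hμL : μ ≤ L)
    (hf : ∀ i, StronglyConvexWith μ (reparam f E i)) (hf' : ∀ i, SmoothWith L (reparam f E i))
    (hzs : ∀ z, dualObj (reparam f E) M zs ≤ dualObj (reparam f E) M z) (hR : ‖zs‖ ≤ R)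
    (hR₀ : ‖z₀ - zs‖ ≤ R) (hγ : 0 ≤ γ) (hε : 0 < ε) (hε1 : ε ≤ 1) {Θ : ℝ}
    (hgap : √(L / μ) * chi M * (lamMax M ^ 2 / μ) * R ^ 2 ≤ 4 * Θ)
    (hres : γ * (lamMax W / lamMinPos M) * (lamMax M ^ 2 / μ * R) ≤ 8 * Θ) {N : ℕ}
    (hN : 10 * (√(L / μ) * chi M * Real.log ((2 + Θ) / ε)) ≤ N) :
    IsAccurate f B W γ ε (locallyDual G W P f E μ L z₀ N).val := by
  obtain ⟨hgap', hres'⟩ :=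
    locallyDual_primal_accuracy (P := P) hW hPM hM hM0 hE hμ hμL hf hf' hzs hR hR₀ hγ N
  set s := √(L / μ) * chi M
  have hs : 1 ≤ s :=
    one_le_mul_of_one_le_of_one_le (one_le_sqrt_div hμ hμL) (one_le_chi hM.posSemidef hM0)
  have hΘ : 0 ≤ Θ := by
    have : 0 ≤ s * (lamMax M ^ 2 / μ) * R ^ 2 := by positivity
    linarith
  have hexp : 2 ^ 4 * Θ * Real.exp (-(N / (2 * s))) ≤ ε :=
    mul_exp_le_of_log_le 4 (by linarith) hΘ hε hε1 (by push_cast; linarith)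
  set δ := Real.exp (-(N / (2 * s)))
  have hδ : 0 ≤ δ := (Real.exp_pos _).le
  constructor
  · intro y hy
    linarith [hgap' y hy, mul_le_mul_of_nonneg_right hgap hδ]
  · linarith [mul_le_mul_of_nonneg_right hres hδ]

theorem locallyDual_plain_complexity (hW : IsMixing G W) (hW0 : W ≠ 0)
    (hE : IsKernelBasis B E) (hμ : 0 < μ) (hμL : μ ≤ L)
    (hf : ∀ i, StronglyConvexWith μ (reparam f E i))
    (hf' : ∀ i, SmoothWith L (reparam f E i))
    (hzs : ∀ z, dualObj (reparam f E) W zs ≤ dualObj (reparam f E) W z) (hR : ‖zs‖ ≤ R)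
    (hR₀ : ‖z₀ - zs‖ ≤ R) (hγ : 0 ≤ γ) (hε : 0 < ε) (hε1 : ε ≤ 1) :
    ∃ N : ℕ,
      (∀ N' ≥ N, IsAccurate f B W γ ε (locallyDual G W Polynomial.X f E μ L z₀ N').val) ∧
      ((locallyDual G W Polynomial.X f E μ L z₀ N).oracleCalls : ℝ) ≤
        30 * (√(L / μ) * chi W * Real.log
          ((2 + √(L / μ) * chi W * (lamMax W ^ 2 / μ) * R * (R + γ)) / ε)) ∧
      ((locallyDual G W Polynomial.X f E μ L z₀ N).communications : ℝ) ≤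
        30 * (√(L / μ) * chi W * Real.log
          ((2 + √(L / μ) * chi W * (lamMax W ^ 2 / μ) * R * (R + γ)) / ε)) := by
  have hσ : 1 ≤ √(L / μ) := one_le_sqrt_div hμ hμL
  have hχ : 1 ≤ chi W := one_le_chi hW.posSemidef hW0
  have hs : 1 ≤ √(L / μ) * chi W := one_le_mul_of_one_le_of_one_le hσ hχ
  have hR0 : 0 ≤ R := (norm_nonneg _).trans hR
  set Θ := √(L / μ) * chi W * (lamMax W ^ 2 / μ) * R * (R + γ)
  have hΘR : 0 ≤ √(L / μ) * chi W * (lamMax W ^ 2 / μ) * R ^ 2 := by positivity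
  have hΘγ : 0 ≤ γ * chi W * (lamMax W ^ 2 / μ * R) := by positivity
  have hΘγ' := le_mul_of_one_le_left hΘγ hσ
  have hlog : 1 / 2 ≤ Real.log ((2 + Θ) / ε) := half_le_log (by positivity) hε hε1
  have hhalf : 1 / 2 ≤ √(L / μ) * chi W * Real.log ((2 + Θ) / ε) := by nlinarith
  have hceil := Nat.ceil_lt_add_one (a := 10 * (√(L / μ) * chi W * Real.log ((2 + Θ) / ε)))
    (by linarith)
  refine ⟨⌈10 * (√(L / μ) * chi W * Real.log ((2 + Θ) / ε))⌉₊, fun N hN => ?_, ?_, ?_⟩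
  · refine locallyDual_isAccurate hW (Polynomial.aeval_X W) hW.isConsensusMatrix hW0 hE hμ hμL
      hf hf' hzs hR hR₀ hγ hε hε1 ?_ ?_ (Nat.ceil_le.1 hN)
    · linarith
    · rw [← chi]
      linarith
  · rw [locallyDual_oracleCalls]
    push_cast
    linarith
  · rw [locallyDual_communications, Polynomial.natDegree_X]
    push_cast
    linarith

theorem locallyDual_chebyshev_isAccurate (hW : IsMixing G W) (hW0 : W ≠ 0) (hE : IsKernelBasis B E)
    (hμ : 0 < μ) (hμL : μ ≤ L) (hf : ∀ i, StronglyConvexWith μ (reparam f E i))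
    (hf' : ∀ i, SmoothWith L (reparam f E i))
    (hzs : ∀ z, dualObj (reparam f E) (Polynomial.aeval W (chebPoly W)) zs ≤
      dualObj (reparam f E) (Polynomial.aeval W (chebPoly W)) z) (hR : ‖zs‖ ≤ R)
    (hR₀ : ‖z₀ - zs‖ ≤ R) (hγ : 0 ≤ γ) (hε : 0 < ε) (hε1 : ε ≤ 1) {N : ℕ}
    (hN : 20 * (√(L / μ) * Real.log
      ((2 + √(L / μ) * (1 / μ) * R * (R + γ * lamMax W)) / ε)) ≤ N) :
    IsAccurate f B W γ ε (locallyDual G W (chebPoly W) f E μ L z₀ N).val := by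
  have hσ : 1 ≤ √(L / μ) := one_le_sqrt_div hμ hμL
  have hw : 0 < lamMax W := lamMax_pos hW.posSemidef hW0
  have hM := hW.isConsensusMatrix.aeval_chebPoly hW0
  have hM0 := aeval_chebPoly_ne_zero hW.posSemidef hW0
  have hχ := chi_aeval_chebPoly_le hW.posSemidef hW0
  have hl := two_thirds_le_lamMinPos_aeval_chebPoly hW.posSemidef hW0
  have hΛ : lamMax (Polynomial.aeval W (chebPoly W)) ^ 2 / μ ≤ 2 * (1 / μ) := by
    have hΛ2 := pow_le_pow_left₀ (lamMax_pos hM.posSemidef hM0).le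
      (lamMax_aeval_chebPoly_le hW.posSemidef hW0) 2
    rw [mul_one_div]
    gcongr
    linarith
  have hR0 : 0 ≤ R := (norm_nonneg _).trans hR
  set Θ := √(L / μ) * (1 / μ) * R * (R + γ * lamMax W)
  have hΘR : 0 ≤ √(L / μ) * (1 / μ) * R ^ 2 := by positivity
  have hΘγ : 0 ≤ γ * lamMax W * (1 / μ * R) := by positivity
  have hlog : 1 / 2 ≤ Real.log ((2 + Θ) / ε) := half_le_log (by positivity) hε hε1
  refine locallyDual_isAccurate hW rfl hM hM0 hE hμ hμL hf hf' hzs hR hR₀ hγ hε hε1 (Θ := Θ)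
    ?_ ?_ ?_
  · calc _ ≤ √(L / μ) * 2 * (2 * (1 / μ)) * R ^ 2 := by gcongr
      _ ≤ 4 * Θ := by linarith [mul_nonneg (zero_le_one.trans hσ) hΘγ]
  · calc _ ≤ γ * (lamMax W / (2 / 3)) * (2 * (1 / μ) * R) := by gcongr
      _ ≤ 8 * Θ := by linarith [le_mul_of_one_le_left hΘγ hσ]
  · calc _ ≤ 10 * (√(L / μ) * 2 * Real.log ((2 + Θ) / ε)) := by gcongr
      _ ≤ N := by linarith

theorem locallyDual_chebyshev_complexity (hW : IsMixing G W) (hW0 : W ≠ 0) (hE : IsKernelBasis B E)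
    (hμ : 0 < μ) (hμL : μ ≤ L) (hf : ∀ i, StronglyConvexWith μ (reparam f E i))
    (hf' : ∀ i, SmoothWith L (reparam f E i))
    (hzs : ∀ z, dualObj (reparam f E) (Polynomial.aeval W (chebPoly W)) zs ≤
      dualObj (reparam f E) (Polynomial.aeval W (chebPoly W)) z) (hR : ‖zs‖ ≤ R)
    (hR₀ : ‖z₀ - zs‖ ≤ R) (hγ : 0 ≤ γ) (hε : 0 < ε) (hε1 : ε ≤ 1) :
    ∃ N : ℕ,
      (∀ N' ≥ N, IsAccurate f B W γ ε (locallyDual G W (chebPoly W) f E μ L z₀ N').val) ∧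
      ((locallyDual G W (chebPoly W) f E μ L z₀ N).oracleCalls : ℝ) ≤
        30 * (√(L / μ) * Real.log
          ((2 + √(L / μ) * (1 / μ) * R * (R + γ * lamMax W)) / ε)) ∧
      ((locallyDual G W (chebPoly W) f E μ L z₀ N).communications : ℝ) ≤
        30 * ((locallyDual G W (chebPoly W) f E μ L z₀ N).oracleCalls * √(chi W)) := by
  have hσ : 1 ≤ √(L / μ) := one_le_sqrt_div hμ hμL
  have hw : 0 < lamMax W := lamMax_pos hW.posSemidef hW0
  have hR0 : 0 ≤ R := (norm_nonneg _).trans hR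
  set ℓ := Real.log ((2 + √(L / μ) * (1 / μ) * R * (R + γ * lamMax W)) / ε)
  have hhalf : 1 / 2 ≤ ℓ := half_le_log (by positivity) hε hε1
  have hσℓ : 1 / 2 ≤ √(L / μ) * ℓ := hhalf.trans (le_mul_of_one_le_left (by linarith) hσ)
  refine ⟨⌈20 * (√(L / μ) * ℓ)⌉₊, fun N hN => ?_, ?_, ?_⟩
  · exact locallyDual_chebyshev_isAccurate hW hW0 hE hμ hμL hf hf' hzs hR hR₀ hγ hε hε1
      (Nat.ceil_le.1 hN)
  · rw [locallyDual_oracleCalls]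
    push_cast
    linarith [Nat.ceil_lt_add_one (a := 20 * (√(L / μ) * ℓ)) (by linarith)]
  · rw [locallyDual_communications, locallyDual_oracleCalls]
    push_cast
    have hdeg := natDegree_chebPoly_le_sqrt hW.posSemidef hW0
    calc _ ≤ (2 * ((⌈20 * (√(L / μ) * ℓ)⌉₊ : ℝ) + 1)) * (3 * √(chi W)) := by
          gcongr
          linarith
      _ ≤ _ := by
          have : 0 ≤ ((⌈20 * (√(L / μ) * ℓ)⌉₊ : ℝ) + 1) * √(chi W) := by positivity
          linarith

end Complexity

end

end LocallyDual

theorem mainTheorem4 :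
    ∃ C : ℝ, 0 < C ∧
    ∀ (m d p r : ℕ) (_ : 2 ≤ m)
      (G : SimpleGraph (Fin m)) (_ : G.Connected)
      (W : Matrix (Fin m) (Fin m) ℝ) (_ : IsMixing G W)
      (B : Matrix (Fin p) (Fin d) ℝ) (_ : ∃ x : Fin d → ℝ, x ≠ 0 ∧ B.mulVec x = 0)
      (E : Matrix (Fin d) (Fin r) ℝ) (_ : IsKernelBasis B E)
      (μ L : ℝ) (_ : 0 < μ)
      (f : Fin m → Vec d → ℝ)
      (_ : ∀ i, StronglyConvexWith μ (f i)) (_ : ∀ i, SmoothWith L (f i)),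
    -- the dimension of the new variable
    r + B.rank = d ∧
    -- the best constants of the `hᵢ` exist and are no worse than those of the `fᵢ`
    (∃ μs Ls : ℝ, IsGreatest {c | ∀ i, StronglyConvexWith c (reparam f E i)} μs ∧
      IsLeast {c | ∀ i, SmoothWith c (reparam f E i)} Ls ∧ μ ≤ μs ∧ Ls ≤ L) ∧
    -- the conjugate under the affine constraints is `H*`, in the coordinates given by `E`
    (∀ v : Stack m d, IsLUB ((fun x => inner ℝ v x - sepSum f x) '' {x | blockAct B x = 0})
      (conjugate (sepSum (reparam f E)) (blockAct E.transpose v))) ∧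
    -- the gradient of `H*` is the unique maximizer in the definition of `H*`
    (∀ z t : Stack m r,
      IsMaxOn (fun t' => inner ℝ z t' - sepSum (reparam f E) t') Set.univ t ↔
        t = gradient (conjugate (sepSum (reparam f E))) z) ∧
    -- strong duality, for the plain and for the accelerated form of the consensus constraint
    (∀ P : Polynomial ℝ, P = Polynomial.X ∨ P = chebPoly W →
      (∃ z, ∀ z', dualObj (reparam f E) (Polynomial.aeval W P) z ≤
        dualObj (reparam f E) (Polynomial.aeval W P) z') ∧
      (∀ z, (∀ z', dualObj (reparam f E) (Polynomial.aeval W P) z ≤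
          dualObj (reparam f E) (Polynomial.aeval W P) z') →
        IsLeast (sepSum f '' feasible B W)
          (-dualObj (reparam f E) (Polynomial.aeval W P) z))) ∧
    -- the method uses gradients of the dual objective, at a cost of `deg P` rounds for each
    -- multiplication by `P(W)`
    (∀ (P : Polynomial ℝ) (z : Stack m r),
      (polyGossip G W P z).val = kronAct (Polynomial.aeval W P) z ∧
      (polyGossip G W P z).communications = P.natDegree ∧
      (dualGrad G W P (reparam f E) z).val =
        gradient (dualObj (reparam f E) (Polynomial.aeval W P)) z) ∧
    -- the Chebyshev polynomial of `W`
    (((chebPoly W).natDegree : ℝ) ≤ C * √(chi W) ∧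
      (Polynomial.aeval W (chebPoly W)).PosSemidef ∧
      (∀ v : Fin m → ℝ, (Polynomial.aeval W (chebPoly W)).mulVec v = 0 ↔ W.mulVec v = 0) ∧
      chi (Polynomial.aeval W (chebPoly W)) ≤ C) ∧
    ∀ (μt Lt : ℝ), 0 < μt → (∀ i, StronglyConvexWith μt (reparam f E i)) →
      (∀ i, SmoothWith Lt (reparam f E i)) →
      -- smoothness and strong convexity of `H*`
      SmoothWith (1 / μt) (conjugate (sepSum (reparam f E))) ∧
      StronglyConvexWith (1 / Lt) (conjugate (sepSum (reparam f E))) ∧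
      -- complexity of the plain method
      (∀ (z₀ zs : Stack m r) (R γ ε : ℝ),
        (∀ z, dualObj (reparam f E) W zs ≤ dualObj (reparam f E) W z) →
        ‖zs‖ ≤ R → ‖z₀ - zs‖ ≤ R → 0 < γ → 0 < ε → ε ≤ 1 →
        ∃ N : ℕ,
          (∀ N' ≥ N, IsAccurate f B W γ ε
            (locallyDual G W Polynomial.X f E μt Lt z₀ N').val) ∧
          ((locallyDual G W Polynomial.X f E μt Lt z₀ N).oracleCalls : ℝ) ≤
            C * (√(Lt / μt) * chi W * Real.log
              ((2 + √(Lt / μt) * chi W * (lamMax W ^ 2 / μt) * R * (R + γ)) / ε)) ∧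
          ((locallyDual G W Polynomial.X f E μt Lt z₀ N).communications : ℝ) ≤
            C * (√(Lt / μt) * chi W * Real.log
              ((2 + √(Lt / μt) * chi W * (lamMax W ^ 2 / μt) * R * (R + γ)) / ε))) ∧
      -- complexity of the Chebyshev accelerated method
      (∀ (z₀ zs : Stack m r) (R γ ε : ℝ),
        (∀ z, dualObj (reparam f E) (Polynomial.aeval W (chebPoly W)) zs ≤
          dualObj (reparam f E) (Polynomial.aeval W (chebPoly W)) z) →
        ‖zs‖ ≤ R → ‖z₀ - zs‖ ≤ R → 0 < γ → 0 < ε → ε ≤ 1 →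
        ∃ N : ℕ,
          (∀ N' ≥ N, IsAccurate f B W γ ε
            (locallyDual G W (chebPoly W) f E μt Lt z₀ N').val) ∧
          ((locallyDual G W (chebPoly W) f E μt Lt z₀ N).oracleCalls : ℝ) ≤
            C * (√(Lt / μt) * Real.log
              ((2 + √(Lt / μt) * (1 / μt) * R * (R + γ * lamMax W)) / ε)) ∧
          ((locallyDual G W (chebPoly W) f E μt Lt z₀ N).communications : ℝ) ≤
            C * ((locallyDual G W (chebPoly W) f E μt Lt z₀ N).oracleCalls * √(chi W))) := by
  refine ⟨30, by norm_num, fun m d p r hm G _ W hW B hB E hE μ L hμ f hf hf' => ?_⟩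
  have : NeZero m := ⟨by omega⟩
  have : Nontrivial (Vec r) := hE.nontrivial hB
  have hWc : IsConsensusMatrix W := hW.isConsensusMatrix
  have hW0 : W ≠ 0 := hWc.ne_zero hm
  have hh := stronglyConvexWith_reparam hf hE.orthonormal
  have hh' := smoothWith_reparam hf' hE.orthonormal
  obtain ⟨μs, hμs⟩ := exists_isGreatest_stronglyConvexWith hh hh'
  obtain ⟨Ls, hLs⟩ := exists_isLeast_smoothWith hh hh'
  refine ⟨hE.card_add_rank, ⟨μs, Ls, hμs, hLs, hμs.2 hh, hLs.2 hh'⟩, hE.isLUB_conjugate hh hμ,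
    fun _ _ => (stronglyConvexWith_sepSum hh).isMaxOn_iff_eq_gradient_conjugate hμ,
    fun P hP => ⟨exists_dualObj_minimizer hh hμ _, fun _ => hE.isLeast_neg_dualObj hWc ?_ hh hμ⟩,
    fun P z => ⟨polyGossip_val hW P z, polyGossip_communications P z, dualGrad_val hW P hh hμ z⟩,
    ⟨(natDegree_chebPoly_le_sqrt hW.posSemidef hW0).trans (by gcongr; norm_num),
      posSemidef_aeval_chebPoly hW.posSemidef hW0,
      aeval_chebPoly_mulVec_eq_zero_iff hW.posSemidef hW0,
      (chi_aeval_chebPoly_le hW.posSemidef hW0).trans (by norm_num)⟩,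
    fun μt Lt hμt hht hht' => ?_⟩
  · rcases hP with rfl | rfl
    · rwa [Polynomial.aeval_X]
    · exact hWc.aeval_chebPoly hW0
  have hμL : μt ≤ Lt := (hht 0).le_of_smoothWith (hht' 0)
  have hH := stronglyConvexWith_sepSum hht
  exact ⟨hH.smoothWith_conjugate hμt,
    (smoothWith_sepSum hht').stronglyConvexWith_conjugate (hμt.trans_le hμL).ne' hH hμt,
    fun z₀ zs R γ ε hzs hR hR₀ hγ =>
      locallyDual_plain_complexity hW hW0 hE hμt hμL hht hht' hzs hR hR₀ hγ.le,
    fun z₀ zs R γ ε hzs hR hR₀ hγ =>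
      locallyDual_chebyshev_complexity hW hW0 hE hμt hμL hht hht' hzs hR hR₀ hγ.le⟩
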